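/- **Setting.** Let $f,g\in C^2(\mathbb R)$ with $f(0)=g(0)=0$, let $\sigma,\alpha>0$ and $c<0$, and let $(\hat u,\hat v)$ be a $C^2$ solution on $\mathbb R$ of $$\hat u''+c\hat u'+f(\hat u)-\sigma\hat v=0,\qquad \hat v''+c\hat v'+g(\hat v)+\alpha\hat u=0 ,$$ i.e. a travelling wave, in $z=x-ct$, of $u_t=u_{xx}+f(u)-\sigma v$, $v_t=v_{xx}+g(v)+\alpha u$. Put $\varphi=(\hat u,\hat v,\hat u'/\sigma,\hat v'/\alpha)$. Assume that the matrix $\begin{pmatrix} f'(0)&-\sigma\\ \alpha& g'(0)\end{pmatrix}$ has real eigenvalues $\nu_1<\nu_2<0$. For $\lambda\in\mathbb C$ put, with the principal square root, $$\mu_{1}(\lambda),\mu_4(\lambda)=-\tfrac c2\mp\tfrac12\sqrt{c^2+4(\lambda-\nu_1)},\qquad \mu_{2}(\lambda),\mu_3(\lambda)=-\tfrac c2\mp\tfrac12\sqrt{c^2+4(\lambda-\nu_2)} .$$ Assume that $e^{-\mu_2(0)z}\varphi(z)$ has a nonzero limit as $z\to\infty$ and $e^{-\mu_3(0)z}\varphi(z)$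 has a nonzero limit as $z\to-\infty$. Let $$A(\lambda,z)=\begin{pmatrix}0&0&\sigma&0\\0&0&0&\alpha\\ \frac{\lambda-f'(\hat u(z))}{\sigma}&1&-c&0\\-1&\frac{\lambda-g'(\hat v(z))}{\alpha}&0&-c\end{pmatrix},$$ let $A_\infty(\lambda)$ be the same matrix with $f'(0),g'(0)$ in place of $f'(\hat u(z)),g'(\hat v(z))$, and for a $4\times4$ matrix $A$ let $A^{(2)}$ be the endomorphism of $\bigwedge^2\mathbb C^4$ with $A^{(2)}(Y_1\wedge Y_2)=AY_1\wedge Y_2+Y_1\wedge AY_2$. **Evans function.** Let $\mathcal U\subset\mathbb C$ be open and simply connected, containing the closed right half-plane, such that $A_\infty(\lambda)$ has no purely imaginary eigenvalue for $\lambda\in\mathcal U$. Let $\zeta_s,\zeta_u:\mathcal U\to\bigwedge^2\mathbb C^4$ be analytic, where $\zeta_s(\lambda)$, $\zeta_u(\lambda)$ are eigenvectors of $A_\infty^{(2)}(\lambda)$ for the eigenvalues $\mu_1(\lambda)+\mu_2(\lambda)$, $\mu_3(\lambda)+\mu_4(\lambda)$. For $\lambda\in\mathcal U$ let $\tilde E^{s}(\lambda,\cdot)$,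 $\tilde E^{u}(\lambda,\cdot)$ be solutions of $Z'=A^{(2)}(\lambda,z)Z$ with $$\lim_{z\to\infty}e^{-(\mu_1(\lambda)+\mu_2(\lambda))z}\tilde E^s(\lambda,z)=\zeta_s(\lambda),\qquad \lim_{z\to-\infty}e^{-(\mu_3(\lambda)+\mu_4(\lambda))z}\tilde E^u(\lambda,z)=\zeta_u(\lambda).$$ The Evans function $D$ is defined by $D(\lambda)\,e_1\wedge e_2\wedge e_3\wedge e_4=e^{2cz}\,\tilde E^s(\lambda,z)\wedge\tilde E^u(\lambda,z)$. **Basis solutions at $\lambda=0$.** Let $u_1,u_4:\mathbb R\to\mathbb R^4$ be solutions of $Y'=A(0,z)Y$ such that $e^{-\mu_1(0)z}u_1(z)$ tends, as $z\to\infty$, to an eigenvector of $A_\infty(0)$ for $\mu_1(0)$, and $e^{-\mu_4(0)z}u_4(z)$ tends, as $z\to-\infty$, to an eigenvector of $A_\infty(0)$ for $\mu_4(0)$, normalized (with $u_2=u_3=\varphi'$) by $$\lim_{z\to\infty}e^{-(\mu_1(0)+\mu_2(0))z}\,u_1\wedge\varphi'=\zeta_s(0),\qquad \lim_{z\to-\infty}e^{-(\mu_3(0)+\mu_4(0))z}\,\varphi'\wedge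 u_4=\zeta_u(0).$$ For $a,b\in\mathbb R^4$ put $\omega(a,b)=(a_1b_3-a_3b_1)-(a_2b_4-a_4b_2)$ and $\Omega(a,b)=e^{cz}\omega(a,b)$. **Lemma 4.2.** For $\lambda\in\mathcal U$ the value $D(\lambda)$ does not depend on $z$; $\Omega(u_1,u_4)=e^{cz}\omega(u_1(z),u_4(z))$ does not depend on $z$; the integral below converges absolutely; and $D$ is complex differentiable at $0$ with $$D'(0)=\Omega(u_1,u_4)\int_{-\infty}^{\infty}e^{cz}\left(\frac{(\hat u')^2}{\sigma}-\frac{(\hat v')^2}{\alpha}\right)dz .$$ -/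

import Mathlib

open Filter Topology MeasureTheory

noncomputable section

/-- Jacobian at the origin of the kinetics `(u, v) ↦ (f u - σ v, g v + α u)`. -/
def kineticsJacobian (f g : ℝ → ℝ) (σ α : ℝ) : Matrix (Fin 2) (Fin 2) ℝ :=
  !![deriv f 0, -σ; α, deriv g 0]

/-- The rate `-c/2 - √(c² - 4ν)/2`: the negative spatial eigenvalue of the rest state attached to
the eigenvalue `ν < 0` of the kinetics Jacobian (for `c < 0`). -/
def rateMinus (c ν : ℝ) : ℝ := -c / 2 - √(c ^ 2 - 4 * ν) / 2

/-- The rate `-c/2 + √(c² - 4ν)/2`: the corresponding positive spatial eigenvalue. -/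
def ratePlus (c ν : ℝ) : ℝ := -c / 2 + √(c ^ 2 - 4 * ν) / 2

/-- `μ(λ) = -c/2 - √(c² + 4(λ - ν))/2`, with the principal square root. -/
def muMinus (c ν : ℝ) (lam : ℂ) : ℂ :=
  -(c : ℂ) / 2 - ((c : ℂ) ^ 2 + 4 * (lam - (ν : ℂ))) ^ (1 / 2 : ℂ) / 2

/-- `μ(λ) = -c/2 + √(c² + 4(λ - ν))/2`, with the principal square root. -/
def muPlus (c ν : ℝ) (lam : ℂ) : ℂ :=
  -(c : ℂ) / 2 + ((c : ℂ) ^ 2 + 4 * (lam - (ν : ℂ))) ^ (1 / 2 : ℂ) / 2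

theorem cpow_half_at_zero (c ν : ℝ) (hν : ν ≤ 0) :
    ((c : ℂ) ^ 2 + 4 * (0 - (ν : ℂ))) ^ (1 / 2 : ℂ) = ((√(c ^ 2 - 4 * ν) : ℝ) : ℂ) := by
  have h : 0 ≤ c ^ 2 - 4 * ν := by nlinarith [sq_nonneg c]
  rw [Real.sqrt_eq_rpow, Complex.ofReal_cpow h]
  congr 1
  · push_cast
    ring
  · push_cast
    rfl

theorem muMinus_zero (c ν : ℝ) (hν : ν ≤ 0) : muMinus c ν 0 = (rateMinus c ν : ℂ) := by
  rw [muMinus, cpow_half_at_zero c ν hν, rateMinus]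
  push_cast
  ring

theorem muPlus_zero (c ν : ℝ) (hν : ν ≤ 0) : muPlus c ν 0 = (ratePlus c ν : ℂ) := by
  rw [muPlus, cpow_half_at_zero c ν hν, ratePlus]
  push_cast
  ring

/-- The profile `φ = (û, v̂, û'/σ, v̂'/α)` in the four-dimensional phase space. -/
def profile (σ α : ℝ) (uh vh : ℝ → ℝ) (z : ℝ) : Fin 4 → ℝ :=
  ![uh z, vh z, deriv uh z / σ, deriv vh z / α]

/-- Its derivative `φ' = (û', v̂', û''/σ, v̂''/α)`. -/
def profileDeriv (σ α : ℝ) (uh vh : ℝ → ℝ) (z : ℝ) : Fin 4 → ℝ :=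
  ![deriv uh z, deriv vh z, deriv (deriv uh) z / σ, deriv (deriv vh) z / α]

/-- Standing assumptions on the system `u_t = u_xx + f u - σ v`, `v_t = v_xx + g v + α u` and its
travelling wave `(û, v̂)` of speed `c < 0`, written in the variable `z = x - c t`: the eigenvalues of
the kinetics Jacobian at the rest state `(0, 0)` are real with `ν₁ < ν₂ < 0`, and the homoclinic
orbit `φ` decays exactly like the leading exponentials, `e^{μ₂ z}` with `μ₂ = rateMinus c ν₂`
forwards, and `e^{μ₃ z}` with `μ₃ = ratePlus c ν₂` backwards. -/
structure IsTravelingWave (f g : ℝ → ℝ) (σ α c ν₁ ν₂ : ℝ) (uh vh : ℝ → ℝ) : Prop where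
  contDiff_f : ContDiff ℝ 2 f
  contDiff_g : ContDiff ℝ 2 g
  sigma_pos : 0 < σ
  alpha_pos : 0 < α
  f_zero : f 0 = 0
  g_zero : g 0 = 0
  speed_neg : c < 0
  eigenvalue_one : Module.End.HasEigenvalue (Matrix.toLin' (kineticsJacobian f g σ α)) ν₁
  eigenvalue_two : Module.End.HasEigenvalue (Matrix.toLin' (kineticsJacobian f g σ α)) ν₂
  eigenvalue_lt : ν₁ < ν₂
  eigenvalue_neg : ν₂ < 0
  contDiff_u : ContDiff ℝ 2 uh
  contDiff_v : ContDiff ℝ 2 vh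
  wave_u : ∀ z, deriv (deriv uh) z + c * deriv uh z + f (uh z) - σ * vh z = 0
  wave_v : ∀ z, deriv (deriv vh) z + c * deriv vh z + g (vh z) + α * uh z = 0
  decay_forward : ∃ χ : Fin 4 → ℝ, χ ≠ 0 ∧
    Tendsto (fun z => Real.exp (-rateMinus c ν₂ * z) • profile σ α uh vh z) atTop (𝓝 χ)
  decay_backward : ∃ χ : Fin 4 → ℝ, χ ≠ 0 ∧
    Tendsto (fun z => Real.exp (-ratePlus c ν₂ * z) • profile σ α uh vh z) atBot (𝓝 χ)

/-- The coefficient matrix of the eigenvalue problem, where `a`, `b` stand for `f'(û(z))`,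
`g'(v̂(z))`, or for their limits `f'(0)`, `g'(0)`. -/
def coeffMatrix {K : Type*} [Field K] (σ α c a b lam : K) : Matrix (Fin 4) (Fin 4) K :=
  !![0, 0, σ, 0;
     0, 0, 0, α;
     (lam - a) / σ, 1, -c, 0;
     -1, (lam - b) / α, 0, -c]

/-- `A(0, z)` as a real matrix. -/
def realMatrix (f g : ℝ → ℝ) (σ α c : ℝ) (uh vh : ℝ → ℝ) (z : ℝ) : Matrix (Fin 4) (Fin 4) ℝ :=
  coeffMatrix σ α c (deriv f (uh z)) (deriv g (vh z)) 0

/-- `A∞(0)` as a real matrix. -/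
def realMatrixInfty (f g : ℝ → ℝ) (σ α c : ℝ) : Matrix (Fin 4) (Fin 4) ℝ :=
  coeffMatrix σ α c (deriv f 0) (deriv g 0) 0

/-- `A(λ, z)`. -/
def matrixA (f g : ℝ → ℝ) (σ α c : ℝ) (uh vh : ℝ → ℝ) (lam : ℂ) (z : ℝ) :
    Matrix (Fin 4) (Fin 4) ℂ :=
  coeffMatrix (σ : ℂ) (α : ℂ) (c : ℂ) ((deriv f (uh z) : ℝ) : ℂ) ((deriv g (vh z) : ℝ) : ℂ) lam

/-- `A∞(λ)`. -/
def matrixAInfty (f g : ℝ → ℝ) (σ α c : ℝ) (lam : ℂ) : Matrix (Fin 4) (Fin 4) ℂ :=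
  coeffMatrix (σ : ℂ) (α : ℂ) (c : ℂ) ((deriv f 0 : ℝ) : ℂ) ((deriv g 0 : ℝ) : ℂ) lam

/-- First index of the `k`-th basis two-vector, in the order `12, 13, 14, 23, 24, 34`. -/
def pairFst : Fin 6 → Fin 4 := ![0, 0, 0, 1, 1, 2]

/-- Second index of the `k`-th basis two-vector, in the order `12, 13, 14, 23, 24, 34`. -/
def pairSnd : Fin 6 → Fin 4 := ![1, 2, 3, 2, 3, 3]

/-- `a ∧ b` in the second exterior power of `K⁴`, which is identified with `K⁶` by the coordinates
in the basis `e₁∧e₂, e₁∧e₃, e₁∧e₄, e₂∧e₃, e₂∧e₄, e₃∧e₄`. -/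
def wedgeTwo {K : Type*} [CommRing K] (a b : Fin 4 → K) : Fin 6 → K :=
  fun k => a (pairFst k) * b (pairSnd k) - a (pairSnd k) * b (pairFst k)

/-- The endomorphism of the second exterior power induced by `A` as a derivation: it maps `e_i ∧ e_j`
to `A e_i ∧ e_j + e_i ∧ A e_j`. -/
def induced {K : Type*} [CommRing K] (A : Matrix (Fin 4) (Fin 4) K) (Z : Fin 6 → K) : Fin 6 → K :=
  ∑ k, Z k • (wedgeTwo (A.mulVec (Pi.single (pairFst k) 1)) (Pi.single (pairSnd k) 1) +
    wedgeTwo (Pi.single (pairFst k) 1) (A.mulVec (Pi.single (pairSnd k) 1)))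

/-- The scalar `d` with `Z ∧ W = d • (e₁ ∧ e₂ ∧ e₃ ∧ e₄)`. -/
def wedgeFour {K : Type*} [CommRing K] (Z W : Fin 6 → K) : K :=
  Z 0 * W 5 - Z 1 * W 4 + Z 2 * W 3 + Z 3 * W 2 - Z 4 * W 1 + Z 5 * W 0

theorem induced_wedgeTwo {K : Type*} [CommRing K] (A : Matrix (Fin 4) (Fin 4) K)
    (a b : Fin 4 → K) :
    induced A (wedgeTwo a b) = wedgeTwo (A.mulVec a) b + wedgeTwo a (A.mulVec b) := by
  funext k
  fin_cases k <;>
    simp [induced, wedgeTwo, pairFst, pairSnd, Fin.sum_univ_succ, Matrix.mulVec, dotProduct,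
      Pi.single_apply] <;> ring

theorem wedgeFour_wedgeTwo {K : Type*} [CommRing K] (a b c d : Fin 4 → K) :
    wedgeFour (wedgeTwo a b) (wedgeTwo c d) = (Matrix.of ![a, b, c, d]).transpose.det := by
  rw [Matrix.det_transpose]
  simp [wedgeFour, wedgeTwo, pairFst, pairSnd, Matrix.det_succ_row_zero, Fin.sum_univ_succ,
    Fin.succAbove]
  ring

/-- The symplectic form `ω = de₁ ∧ de₃ - de₂ ∧ de₄`. -/
def omegaForm (a b : Fin 4 → ℝ) : ℝ :=
  (a 0 * b 2 - a 2 * b 0) - (a 1 * b 3 - a 3 * b 1)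

/-- The weighted form `Ω = e^{cz} ω` at the point `z`. -/
def weightedOmega (c z : ℝ) (a b : Fin 4 → ℝ) : ℝ := Real.exp (c * z) * omegaForm a b

/-- Domains of the Evans function: open, simply connected, containing the closed right half-plane,
and such that `A∞(λ)` is hyperbolic for every `λ` in the domain. -/
structure IsEvansDomain (f g : ℝ → ℝ) (σ α c : ℝ) (U : Set ℂ) : Prop where
  isOpen : IsOpen U
  simplyConnected : SimplyConnectedSpace U
  halfPlane : ∀ lam : ℂ, 0 ≤ lam.re → lam ∈ U
  hyperbolic : ∀ lam ∈ U, ∀ μ : ℂ,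
    Module.End.HasEigenvalue (Matrix.toLin' (matrixAInfty f g σ α c lam)) μ → μ.re ≠ 0

/-- `Es` is a stable two-vector with analytic asymptotic eigenvector `ζ`: `Es λ` solves
`Z' = A⁽²⁾(λ, z) Z`, and `e^{-(μ₁(λ)+μ₂(λ))z} Es λ z → ζ λ` as `z → ∞`, with `ζ λ` an eigenvector of
`A∞⁽²⁾(λ)` for `μ₁(λ) + μ₂(λ)`. -/
structure IsStableTwoVector (f g : ℝ → ℝ) (σ α c ν₁ ν₂ : ℝ) (uh vh : ℝ → ℝ) (U : Set ℂ)
    (ζ : ℂ → Fin 6 → ℂ) (Es : ℂ → ℝ → Fin 6 → ℂ) : Prop where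
  analytic : AnalyticOnNhd ℂ ζ U
  ne_zero : ∀ lam ∈ U, ζ lam ≠ 0
  eigenvector : ∀ lam ∈ U,
    induced (matrixAInfty f g σ α c lam) (ζ lam) = (muMinus c ν₁ lam + muMinus c ν₂ lam) • ζ lam
  solution : ∀ lam ∈ U, ∀ z : ℝ,
    HasDerivAt (Es lam) (induced (matrixA f g σ α c uh vh lam z) (Es lam z)) z
  limit : ∀ lam ∈ U, Tendsto
    (fun z : ℝ => Complex.exp (-(muMinus c ν₁ lam + muMinus c ν₂ lam) * z) • Es lam z)
    atTop (𝓝 (ζ lam))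

/-- `Eu` is an unstable two-vector with analytic asymptotic eigenvector `ζ`: `Eu λ` solves
`Z' = A⁽²⁾(λ, z) Z`, and `e^{-(μ₃(λ)+μ₄(λ))z} Eu λ z → ζ λ` as `z → -∞`, with `ζ λ` an eigenvector of
`A∞⁽²⁾(λ)` for `μ₃(λ) + μ₄(λ)`. -/
structure IsUnstableTwoVector (f g : ℝ → ℝ) (σ α c ν₁ ν₂ : ℝ) (uh vh : ℝ → ℝ) (U : Set ℂ)
    (ζ : ℂ → Fin 6 → ℂ) (Eu : ℂ → ℝ → Fin 6 → ℂ) : Prop where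
  analytic : AnalyticOnNhd ℂ ζ U
  ne_zero : ∀ lam ∈ U, ζ lam ≠ 0
  eigenvector : ∀ lam ∈ U,
    induced (matrixAInfty f g σ α c lam) (ζ lam) = (muPlus c ν₂ lam + muPlus c ν₁ lam) • ζ lam
  solution : ∀ lam ∈ U, ∀ z : ℝ,
    HasDerivAt (Eu lam) (induced (matrixA f g σ α c uh vh lam z) (Eu lam z)) z
  limit : ∀ lam ∈ U, Tendsto
    (fun z : ℝ => Complex.exp (-(muPlus c ν₂ lam + muPlus c ν₁ lam) * z) • Eu lam z)
    atBot (𝓝 (ζ lam))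

/-- The Evans function `D(λ)`, given by `D(λ) e₁∧e₂∧e₃∧e₄ = e^{2cz} Es(λ,z) ∧ Eu(λ,z)`, computed at
the point `z`. -/
def evansFunction (c : ℝ) (Es Eu : ℂ → ℝ → Fin 6 → ℂ) (z : ℝ) (lam : ℂ) : ℂ :=
  Complex.exp (2 * (c : ℂ) * (z : ℂ)) * wedgeFour (Es lam z) (Eu lam z)

/-- `u` is a real solution of `Y' = A(0, z) Y` such that `e^{-μz} u(z)` tends along `l` to an
eigenvector of `A∞(0)` for the eigenvalue `μ`. -/
structure IsExpSolution (f g : ℝ → ℝ) (σ α c : ℝ) (uh vh : ℝ → ℝ) (μ : ℝ) (l : Filter ℝ)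
    (u : ℝ → Fin 4 → ℝ) : Prop where
  solution : ∀ z, HasDerivAt u ((realMatrix f g σ α c uh vh z).mulVec (u z)) z
  limit : ∃ η : Fin 4 → ℝ, η ≠ 0 ∧ (realMatrixInfty f g σ α c).mulVec η = μ • η ∧
    Tendsto (fun z => Real.exp (-μ * z) • u z) l (𝓝 η)

end

/-! Write μᵢ for the four rates at λ = 0, B = ∂A/∂λ (`paramMatrix`) and φ' for `profileDeriv`. The
proof never differentiates the solutions in λ; Lipschitz dependence at λ = 0, uniform on half-lines,
suffices.

If Z and W solve the induced equation at λ and λ', then trace A = -2c and trace B = 0 give (e^{2cz}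
Z ∧ W)' = (λ - λ') e^{2cz} B⁽²⁾Z ∧ W (`hasDerivAt_exp_mul_wedgeFour`). With λ = λ' this makes D
independent of z, so D is computed at z = 0. The rates μ₁ + μ₂ and μ₃ + μ₄ are extreme, so the
limits at infinity determine the solutions: Es(0) = u₁ ∧ φ' and Eu(0) = φ' ∧ u₄. These share the
factor φ', whence D(0) = 0 and, at z = 0, D(λ) = (Es(λ) - Es(0)) ∧ (Eu(λ) - Eu(0)) + Es(λ) ∧ Eu(0) +
Es(0) ∧ Eu(λ). The first term is O(λ²). The second, weighted by e^{2cz}, vanishes at +∞, so it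
equals -λ times the integral of its integrand over (0, ∞); the third is treated likewise on (-∞, 0).
Dividing by λ, dominated convergence gives D'(0) = -∫ e^{2cz} B⁽²⁾(u₁ ∧ φ') ∧ (φ' ∧ u₄) dz.

Finally, Ω is constant along pairs of solutions at λ = 0 and decay forces ω(u₁, φ') = ω(φ', u₄) = 0.
As ω ∧ ω / 2 is the volume form, the integrand is the Pfaffian -Ω(u₁, u₄) e^{cz} ω(φ', Bφ')
(`wedgeFour_paramMatrix`), with ω(φ', Bφ') = û'²/σ - v̂'²/α.

The analytic input is a Gronwall estimate for the energy in eigencoordinates of the limit operator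
(`norm_sq_le_of_tendsto_zero`), applied to a solution minus its limit and then to differences in λ.
-/

noncomputable section

/-! ### Gronwall estimates in eigencoordinates -/

section Coordinates

variable {E ι : Type*} [NormedAddCommGroup E] [NormedSpace ℂ E] [Fintype ι]

/-- `P` is diagonal with eigenvalues `θ` in the coordinates `ℓ` attached to the vectors `w`, with
quantitative bounds on the coordinates and the vectors. -/
structure IsDiagonalFrame (P : E →L[ℂ] E) (ℓ : ι → E →L[ℂ] ℂ) (w : ι → E) (θ : ι → ℂ)
    (a b : ℝ) : Prop where
  eigen : ∀ k x, ℓ k (P x) = θ k * ℓ k x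
  expand : ∀ x, x = ∑ k, ℓ k x • w k
  coord_le : ∀ k, ‖ℓ k‖ ≤ a
  vector_le : ∀ k, ‖w k‖ ≤ b

/-- The sum of the squared moduli of the coordinates. -/
def energy (ℓ : ι → E →L[ℂ] ℂ) (x : E) : ℝ := ∑ k, ‖ℓ k x‖ ^ 2

theorem energy_nonneg (ℓ : ι → E →L[ℂ] ℂ) (x : E) : 0 ≤ energy ℓ x :=
  Finset.sum_nonneg fun _ _ => by positivity

theorem sq_le_energy (ℓ : ι → E →L[ℂ] ℂ) (k : ι) (x : E) : ‖ℓ k x‖ ^ 2 ≤ energy ℓ x :=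
  Finset.single_le_sum (f := fun k => ‖ℓ k x‖ ^ 2) (fun _ _ => by positivity) (Finset.mem_univ k)

theorem IsDiagonalFrame.norm_sq_le {P : E →L[ℂ] E} {ℓ : ι → E →L[ℂ] ℂ} {w : ι → E} {θ : ι → ℂ}
    {a b : ℝ} (h : IsDiagonalFrame P ℓ w θ a b) (x : E) :
    ‖x‖ ^ 2 ≤ b ^ 2 * Fintype.card ι * energy ℓ x := by
  have h1 : ‖x‖ ≤ ∑ k, ‖ℓ k x‖ * b := by
    conv_lhs => rw [h.expand x]
    refine (norm_sum_le _ _).trans (Finset.sum_le_sum fun k _ => ?_)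
    rw [norm_smul]
    exact mul_le_mul_of_nonneg_left (h.vector_le k) (norm_nonneg _)
  rw [← Finset.sum_mul] at h1
  have h2 : (∑ k, ‖ℓ k x‖) ^ 2 ≤ Fintype.card ι * energy ℓ x := sq_sum_le_card_mul_sum_sq
  calc ‖x‖ ^ 2 ≤ ((∑ k, ‖ℓ k x‖) * b) ^ 2 := by gcongr
    _ = b ^ 2 * (∑ k, ‖ℓ k x‖) ^ 2 := by ring
    _ ≤ b ^ 2 * (Fintype.card ι * energy ℓ x) := by gcongr
    _ = _ := by ring

theorem IsDiagonalFrame.neg {P : E →L[ℂ] E} {ℓ : ι → E →L[ℂ] ℂ} {w : ι → E} {θ : ι → ℂ}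
    {a b : ℝ} (h : IsDiagonalFrame P ℓ w θ a b) : IsDiagonalFrame (-P) ℓ w (-θ) a b where
  eigen k x := by simp [h.eigen k x]
  expand := h.expand
  coord_le := h.coord_le
  vector_le := h.vector_le

theorem IsDiagonalFrame.sub_smul {P : E →L[ℂ] E} {ℓ : ι → E →L[ℂ] ℂ} {w : ι → E} {θ : ι → ℂ}
    {a b : ℝ} (h : IsDiagonalFrame P ℓ w θ a b) (m : ℂ) :
    IsDiagonalFrame (P - m • ContinuousLinearMap.id ℂ E) ℓ w (fun k => θ k - m) a b where
  eigen k x := by simp [h.eigen k x]; ring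
  expand := h.expand
  coord_le := h.coord_le
  vector_le := h.vector_le

/-- The constant in the differential inequality for the energy. -/
def energyConst (ι : Type*) [Fintype ι] (a b : ℝ) : ℝ :=
  Fintype.card ι * |a| * (2 + b ^ 2 * Fintype.card ι)

theorem energyConst_nonneg (ι : Type*) [Fintype ι] (a b : ℝ) : 0 ≤ energyConst ι a b := by
  unfold energyConst; positivity

theorem hasDerivAt_energy (ℓ : ι → E →L[ℂ] ℂ) {V : ℝ → E} {V' : E} {z : ℝ}
    (hV : HasDerivAt V V' z) :
    HasDerivAt (fun z => energy ℓ (V z)) (∑ k, 2 * inner ℝ (ℓ k (V z)) (ℓ k V')) z := by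
  unfold energy
  refine HasDerivAt.fun_sum fun k _ => ?_
  exact (((ℓ k).restrictScalars ℝ).hasFDerivAt.comp_hasDerivAt z hV).norm_sq

/-- The diagonal part contributes exactly the sum of 2 Re θₖ |ℓₖ x|²; everything else is of size ρ.
Scaling the forcing as ε ρ lets it be absorbed into N + ε², so the resulting inequality is linear in
N + ε² and Gronwall applies. -/
theorem abs_energy_deriv_sub_le {P R : E →L[ℂ] E} {ℓ : ι → E →L[ℂ] ℂ} {w : ι → E} {θ : ι → ℂ}
    {a b ρ ε : ℝ} (h : IsDiagonalFrame P ℓ w θ a b) (hρ : 0 ≤ ρ) (hR : ‖R‖ ≤ ρ)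
    {x y : E} (hy : ‖y‖ ≤ ε * ρ) :
    |∑ k, 2 * inner ℝ (ℓ k x) (ℓ k (P x + R x + y)) - ∑ k, 2 * ((θ k).re * ‖ℓ k x‖ ^ 2)| ≤
      energyConst ι a b * ρ * (energy ℓ x + ε ^ 2) := by
  have hN := energy_nonneg ℓ x
  rw [← Finset.sum_sub_distrib]
  have key : ∀ k, |2 * inner ℝ (ℓ k x) (ℓ k (P x + R x + y)) - 2 * ((θ k).re * ‖ℓ k x‖ ^ 2)| ≤
      |a| * (2 + b ^ 2 * Fintype.card ι) * ρ * (energy ℓ x + ε ^ 2) := by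
    intro k
    have e1 : 2 * inner ℝ (ℓ k x) (ℓ k (P x + R x + y)) - 2 * ((θ k).re * ‖ℓ k x‖ ^ 2) =
        2 * inner ℝ (ℓ k x) (ℓ k (R x + y)) := by
      have : inner ℝ (ℓ k x) (θ k * ℓ k x) = (θ k).re * ‖ℓ k x‖ ^ 2 := by
        rw [Complex.inner, ← Complex.normSq_eq_norm_sq, mul_assoc, Complex.mul_conj,
          Complex.re_mul_ofReal]
      rw [add_assoc, map_add, inner_add_right, h.eigen, this]
      ring
    rw [e1, abs_mul, abs_two]
    have e2 : |inner ℝ (ℓ k x) (ℓ k (R x + y))| ≤ ‖ℓ k x‖ * (|a| * (ρ * ‖x‖ + ε * ρ)) := by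
      refine (abs_real_inner_le_norm _ _).trans ?_
      gcongr
      refine ((ℓ k).le_opNorm _).trans ?_
      have := (h.coord_le k).trans (le_abs_self a)
      gcongr
      refine (norm_add_le _ _).trans ?_
      gcongr
      exact (R.le_opNorm x).trans (by gcongr)
    have e3 := sq_le_energy ℓ k x
    have e4 := h.norm_sq_le x
    set t := ‖ℓ k x‖
    set s := ‖x‖
    set N := energy ℓ x
    set B := b ^ 2 * (Fintype.card ι : ℝ)
    have hB : 0 ≤ B := by positivity
    -- From 2ts ≤ t² + s² and 2tε ≤ t² + ε², with t² ≤ N and s² ≤ BN.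
    have e5 : 2 * (t * (s + ε)) ≤ (2 + B) * (N + ε ^ 2) := by
      nlinarith [sq_nonneg (t - s), sq_nonneg (t - ε), mul_nonneg hB (sq_nonneg ε)]
    calc 2 * |inner ℝ (ℓ k x) (ℓ k (R x + y))| ≤ 2 * (t * (|a| * (ρ * s + ε * ρ))) := by gcongr
      _ = |a| * ρ * (2 * (t * (s + ε))) := by ring
      _ ≤ |a| * ρ * ((2 + B) * (N + ε ^ 2)) := by gcongr
      _ = _ := by ring
  refine (Finset.abs_sum_le_sum_abs _ _).trans ((Finset.sum_le_sum fun k _ => key k).trans ?_)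
  rw [Finset.sum_const, Finset.card_univ, nsmul_eq_mul, energyConst]
  apply le_of_eq
  ring

/-- The integrating factor for the integrable rate K e^{-δz}: s = -1 serves lower bounds on the
derivative, s = 1 upper bounds. -/
theorem hasDerivAt_exp_weight {K δ : ℝ} (hδ : 0 < δ) (s z : ℝ) :
    HasDerivAt (fun z => Real.exp (s * (K / δ) * Real.exp (-δ * z)))
      (-(s * K * Real.exp (-δ * z)) * Real.exp (s * (K / δ) * Real.exp (-δ * z))) z := by
  have h1 : HasDerivAt (fun z : ℝ => Real.exp (-δ * z)) (Real.exp (-δ * z) * (-δ)) z := by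
    simpa using ((hasDerivAt_id z).const_mul (-δ)).exp
  have h2 := (h1.const_mul (s * (K / δ))).exp
  convert h2 using 1
  field_simp

theorem tendsto_exp_neg_mul {δ : ℝ} (hδ : 0 < δ) :
    Tendsto (fun z : ℝ => Real.exp (-δ * z)) atTop (𝓝 0) := by
  refine Real.tendsto_exp_atBot.comp ?_
  exact tendsto_id.const_mul_atTop_of_neg (by linarith)

/-- Gronwall started at infinity: the product of N + e with the integrating factor is nondecreasing
and tends to e, because N vanishes and the factor tends to 1. -/
theorem add_le_of_deriv_ge {N N' : ℝ → ℝ} {K δ e : ℝ} (hδ : 0 < δ)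
    (hN : ∀ z, HasDerivAt N (N' z) z) (hlim : Tendsto N atTop (𝓝 0)) {z : ℝ}
    (h : ∀ s, z ≤ s → -(K * Real.exp (-δ * s) * (N s + e)) ≤ N' s) :
    N z + e ≤ e * Real.exp (K / δ * Real.exp (-δ * z)) := by
  have hd := fun s => ((hN s).add_const e).mul (hasDerivAt_exp_weight (K := K) hδ (-1) s)
  have hm : MonotoneOn (fun s => (N s + e) * Real.exp ((-1) * (K / δ) * Real.exp (-δ * s)))
      (Set.Ici z) := by
    refine monotoneOn_of_hasDerivWithinAt_nonneg (convex_Ici z)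
      (fun s _ => (hd s).continuousAt.continuousWithinAt)
      (fun s _ => (hd s).hasDerivWithinAt) fun s hs => ?_
    have := h s (interior_subset hs)
    have h0 := Real.exp_nonneg ((-1) * (K / δ) * Real.exp (-δ * s))
    nlinarith
  have hl : Tendsto (fun z => (N z + e) * Real.exp ((-1) * (K / δ) * Real.exp (-δ * z)))
      atTop (𝓝 ((0 + e) * Real.exp ((-1) * (K / δ) * 0))) :=
    (hlim.add_const e).mul
      ((Real.continuous_exp.tendsto _).comp ((tendsto_exp_neg_mul hδ).const_mul _))
  have h1 := ge_of_tendsto hl (eventually_ge_atTop z |>.mono fun s hs =>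
    hm Set.self_mem_Ici hs hs)
  simp only [mul_zero, Real.exp_zero, mul_one, zero_add] at h1
  have h2 : N z + e = ((N z + e) * Real.exp ((-1) * (K / δ) * Real.exp (-δ * z))) *
      Real.exp (K / δ * Real.exp (-δ * z)) := by
    rw [mul_assoc, ← Real.exp_add]
    ring_nf
    simp
  rw [h2]
  gcongr

/-- Forward Gronwall; K/δ is the total mass of K e^{-δz} on the half-line, so the bound is uniform.
-/
theorem le_of_deriv_le {N N' : ℝ → ℝ} {K δ : ℝ} (hδ : 0 < δ) (hK : 0 ≤ K)
    (hN : ∀ z, HasDerivAt N (N' z) z) (hN0 : ∀ z, 0 ≤ N z)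
    (h : ∀ z, N' z ≤ K * Real.exp (-δ * z) * N z) {z : ℝ} (hz : 0 ≤ z) :
    N z ≤ N 0 * Real.exp (K / δ) := by
  have hm : Antitone fun z => N z * Real.exp (1 * (K / δ) * Real.exp (-δ * z)) := by
    refine antitone_of_hasDerivAt_nonpos
      (fun z => (hN z).mul (hasDerivAt_exp_weight hδ 1 z)) fun z => ?_
    have := h z
    have h0 := Real.exp_nonneg (1 * (K / δ) * Real.exp (-δ * z))
    simp only [Pi.zero_apply]
    nlinarith
  have h1 := hm hz
  simp only [one_mul, mul_zero, Real.exp_zero, mul_one] at h1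
  refine le_trans ?_ h1
  refine le_mul_of_one_le_right (hN0 z) (Real.one_le_exp (by positivity))

/-- A solution of `V' = P V + R V + h` that vanishes at `∞` is controlled by `h` if all the
eigenvalues of `P` have nonnegative real part. -/
theorem norm_sq_le_of_tendsto_zero {P : E →L[ℂ] E} {ℓ : ι → E →L[ℂ] ℂ} {w : ι → E} {θ : ι → ℂ}
    {a b r δ ε : ℝ} (hF : IsDiagonalFrame P ℓ w θ a b) (hθ : ∀ k, 0 ≤ (θ k).re)
    (hr : 0 ≤ r) (hδ : 0 < δ) {R : ℝ → E →L[ℂ] E} {h V : ℝ → E} {z : ℝ}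
    (hR : ∀ s, z ≤ s → ‖R s‖ ≤ r * Real.exp (-δ * s))
    (hh : ∀ s, z ≤ s → ‖h s‖ ≤ ε * (r * Real.exp (-δ * s)))
    (hV : ∀ s, HasDerivAt V (P (V s) + R s (V s) + h s) s)
    (hlim : Tendsto V atTop (𝓝 0)) :
    ‖V z‖ ^ 2 ≤ b ^ 2 * Fintype.card ι *
      (ε ^ 2 * (Real.exp (energyConst ι a b * r / δ * Real.exp (-δ * z)) - 1)) := by
  refine (hF.norm_sq_le _).trans ?_
  gcongr
  have hl : Tendsto (fun z => energy ℓ (V z)) atTop (𝓝 0) := by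
    have : Tendsto (fun z => energy ℓ (V z)) atTop (𝓝 (energy ℓ 0)) := by
      unfold energy
      exact tendsto_finsetSum _ fun k _ => (((ℓ k).continuous.tendsto _).comp hlim).norm.pow 2
    simpa [energy] using this
  have := add_le_of_deriv_ge (e := ε ^ 2) (K := energyConst ι a b * r) hδ
    (fun s => hasDerivAt_energy ℓ (hV s)) hl (z := z) (fun s hs => ?_)
  · linarith
  · have h1 := abs_le.1 (abs_energy_deriv_sub_le hF (by positivity) (hR s hs) (x := V s) (hh s hs))
    have h2 : 0 ≤ ∑ k, 2 * ((θ k).re * ‖ℓ k (V s)‖ ^ 2) :=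
      Finset.sum_nonneg fun k _ => mul_nonneg (by norm_num) (mul_nonneg (hθ k) (by positivity))
    have h3 := h1.1
    rw [← mul_assoc] at h3
    linarith

/-- A solution of `V' = P V + R V` stays bounded if all the eigenvalues of `P` have nonpositive real
part. -/
theorem exists_norm_le_of_re_nonpos {P : E →L[ℂ] E} {ℓ : ι → E →L[ℂ] ℂ} {w : ι → E} {θ : ι → ℂ}
    {a b r δ : ℝ} (hF : IsDiagonalFrame P ℓ w θ a b) (hθ : ∀ k, (θ k).re ≤ 0)
    (hr : 0 ≤ r) (hδ : 0 < δ) {R : ℝ → E →L[ℂ] E} {V : ℝ → E}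
    (hR : ∀ z, ‖R z‖ ≤ r * Real.exp (-δ * z))
    (hV : ∀ z, HasDerivAt V (P (V z) + R z (V z)) z) :
    ∃ C, ∀ z, 0 ≤ z → ‖V z‖ ≤ C := by
  refine ⟨√(b ^ 2 * Fintype.card ι * (energy ℓ (V 0) *
    Real.exp (energyConst ι a b * r / δ))), fun z hz => Real.le_sqrt_of_sq_le ?_⟩
  refine (hF.norm_sq_le _).trans ?_
  gcongr
  refine le_of_deriv_le hδ (mul_nonneg (energyConst_nonneg ι a b) hr)
    (fun z => hasDerivAt_energy ℓ (hV z)) (fun z => energy_nonneg ℓ _) (fun z => ?_) hz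
  have h1 := abs_le.1 (abs_energy_deriv_sub_le hF (ε := 0) (y := 0) (by positivity) (hR z)
    (x := V z) (by simp))
  have h2 : ∑ k, 2 * ((θ k).re * ‖ℓ k (V z)‖ ^ 2) ≤ 0 :=
    Finset.sum_nonpos fun k _ => mul_nonpos_of_nonneg_of_nonpos (by norm_num)
      (mul_nonpos_of_nonpos_of_nonneg (hθ k) (by positivity))
  have h3 := h1.2
  simp only [add_zero, ne_eq, OfNat.ofNat_ne_zero, not_false_eq_true, zero_pow] at h3
  rw [← mul_assoc] at h3
  linarith

end Coordinates

/-! ### Uniqueness and Lipschitz dependence of solutions prescribed at infinity -/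

section Families

variable {E ι : Type*} [NormedAddCommGroup E] [NormedSpace ℂ E] [Fintype ι]

theorem hasDerivAt_exp_smul {B R : E →L[ℂ] E} {Z : ℝ → E} {z : ℝ} (m : ℂ)
    (hZ : HasDerivAt Z (B (Z z) + R (Z z)) z) :
    HasDerivAt (fun z : ℝ => Complex.exp (-m * z) • Z z)
      ((B - m • ContinuousLinearMap.id ℂ E) (Complex.exp (-m * z) • Z z) +
        R (Complex.exp (-m * z) • Z z)) z := by
  have h1 : HasDerivAt (fun z : ℝ => Complex.exp (-m * z)) (Complex.exp (-m * z) * (-m)) z := by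
    have : HasDerivAt (fun z : ℂ => Complex.exp (-m * z)) (Complex.exp (-m * z) * (-m)) (z : ℂ) := by
      simpa using ((hasDerivAt_id (z : ℂ)).const_mul (-m)).cexp
    exact this.comp_ofReal
  refine (h1.smul hZ).congr_deriv ?_
  simp only [map_smul, sub_apply, smul_apply, ContinuousLinearMap.id_apply]
  module

/-- Two solutions with the same leading coefficient at `∞` coincide, when the leading rate is the
smallest real part of an eigenvalue. -/
theorem eq_of_same_limit {B : E →L[ℂ] E} {ℓ : ι → E →L[ℂ] ℂ} {w : ι → E} {θ : ι → ℂ}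
    {a b r δ : ℝ} {m : ℂ} (hF : IsDiagonalFrame B ℓ w θ a b) (hθ : ∀ k, m.re ≤ (θ k).re)
    (hr : 0 ≤ r) (hδ : 0 < δ) {R : ℝ → E →L[ℂ] E} {Z₁ Z₂ : ℝ → E} {ζ : E}
    (hR : ∀ z, ‖R z‖ ≤ r * Real.exp (-δ * z))
    (h₁ : ∀ z, HasDerivAt Z₁ (B (Z₁ z) + R z (Z₁ z)) z)
    (h₂ : ∀ z, HasDerivAt Z₂ (B (Z₂ z) + R z (Z₂ z)) z)
    (l₁ : Tendsto (fun z : ℝ => Complex.exp (-m * z) • Z₁ z) atTop (𝓝 ζ))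
    (l₂ : Tendsto (fun z : ℝ => Complex.exp (-m * z) • Z₂ z) atTop (𝓝 ζ)) (z : ℝ) :
    Z₁ z = Z₂ z := by
  have h := norm_sq_le_of_tendsto_zero (hF.sub_smul m) (fun k => by simpa using hθ k) hr hδ
    (h := fun _ => 0) (ε := 0) (V := fun z => Complex.exp (-m * z) • Z₁ z -
      Complex.exp (-m * z) • Z₂ z) (z := z) (fun s _ => hR s) (by simp) (fun z => ?_)
    (by simpa using l₁.sub l₂)
  · have h0 : ‖Complex.exp (-m * z) • Z₁ z - Complex.exp (-m * z) • Z₂ z‖ ^ 2 ≤ 0 := by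
      simpa using h
    have h1 := norm_eq_zero.1 (pow_eq_zero_iff two_ne_zero |>.1 (le_antisymm h0 (by positivity)))
    rw [← smul_sub, smul_eq_zero] at h1
    exact sub_eq_zero.1 (h1.resolve_left (Complex.exp_ne_zero _))
  · refine ((hasDerivAt_exp_smul m (h₁ z)).sub (hasDerivAt_exp_smul m (h₂ z))).congr_deriv ?_
    simp only [map_sub, add_zero]
    abel

theorem exp_mul_sub_one_le {q t : ℝ} (hq : 0 ≤ q) (h0 : 0 ≤ t) (h1 : t ≤ 1) :
    Real.exp (q * t) - 1 ≤ q * Real.exp q * t := by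
  have h1 := Real.add_one_le_exp (-(q * t))
  have h2 : Real.exp (q * t) * Real.exp (-(q * t)) = 1 := by rw [← Real.exp_add]; simp
  have h3 : Real.exp (q * t) ≤ Real.exp q := Real.exp_le_exp.2 (mul_le_of_le_one_right hq ‹_›)
  have h4 := Real.exp_nonneg (q * t)
  have h5 : 0 ≤ q * t := mul_nonneg hq h0
  nlinarith

/-- The solution with prescribed leading coefficient, in weighted form, is bounded and depends on
the parameter in a Lipschitz way at `0`, uniformly on the half-line. -/
theorem exists_weighted_lipschitz {B : ℂ → E →L[ℂ] E} {R : ℝ → E →L[ℂ] E} {m : ℂ → ℂ}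
    {ζ : ℂ → E} {Z : ℂ → ℝ → E} {a b r δ : ℝ} (hr : 0 ≤ r) (hδ : 0 < δ)
    (hR : ∀ z, ‖R z‖ ≤ r * Real.exp (-δ * z))
    (hF : ∀ᶠ lam in 𝓝 (0 : ℂ), ∃ (ℓ : ι → E →L[ℂ] ℂ) (w : ι → E) (θ : ι → ℂ),
      IsDiagonalFrame (B lam) ℓ w θ a b ∧ ∀ k, (m lam).re ≤ (θ k).re)
    (hB : DifferentiableAt ℂ B 0) (hm : DifferentiableAt ℂ m 0) (hζ : DifferentiableAt ℂ ζ 0)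
    (heig : ∀ᶠ lam in 𝓝 (0 : ℂ), B lam (ζ lam) = m lam • ζ lam)
    (hZ : ∀ᶠ lam in 𝓝 (0 : ℂ), ∀ z, HasDerivAt (Z lam) (B lam (Z lam z) + R z (Z lam z)) z)
    (hlim : ∀ᶠ lam in 𝓝 (0 : ℂ),
      Tendsto (fun z : ℝ => Complex.exp (-m lam * z) • Z lam z) atTop (𝓝 (ζ lam))) :
    ∃ C, ∀ᶠ lam in 𝓝 (0 : ℂ), ∀ z : ℝ, 0 ≤ z → ‖Complex.exp (-m lam * z) • Z lam z‖ ≤ C ∧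
      ‖Complex.exp (-m lam * z) • Z lam z - Complex.exp (-m 0 * z) • Z 0 z‖ ≤ C * ‖lam‖ := by
  set P : ℂ → E →L[ℂ] E := fun lam => B lam - m lam • ContinuousLinearMap.id ℂ E with hP
  have hPd : DifferentiableAt ℂ P 0 := hB.sub (hm.smul_const _)
  -- Subtracting ζ turns the limit into 0. As P λ annihilates ζ λ, the only forcing left is R ζ,
  -- which decays exponentially.
  set V : ℂ → ℝ → E := fun lam z => Complex.exp (-m lam * z) • Z lam z - ζ lam with hV
  obtain ⟨C₂, hC₂0, hC₂⟩ := hζ.isBigO_sub.exists_nonneg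
  obtain ⟨C₃, hC₃0, hC₃⟩ := hPd.isBigO_sub.exists_nonneg
  have hζb : ∀ᶠ lam in 𝓝 (0 : ℂ), ‖ζ lam‖ ≤ ‖ζ 0‖ + 1 := by
    have := hζ.continuousAt.norm.eventually (eventually_lt_nhds (lt_add_one ‖ζ 0‖))
    filter_upwards [this] with lam h using h.le
  have hgood : ∀ᶠ lam in 𝓝 (0 : ℂ), (∀ z, HasDerivAt (V lam)
      (P lam (V lam z) + R z (V lam z) + R z (ζ lam)) z) ∧ Tendsto (V lam) atTop (𝓝 0) := by
    filter_upwards [heig, hZ, hlim] with lam h1 h2 h3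
    refine ⟨fun z => ?_, by simpa [hV] using h3.sub_const (ζ lam)⟩
    refine ((hasDerivAt_exp_smul (m lam) (h2 z)).sub_const (ζ lam)).congr_deriv ?_
    have : P lam (ζ lam) = 0 := by simp [hP, h1]
    simp only [hV, map_sub, this]
    simp only [hP]
    abel
  set q := energyConst ι a b * r / δ with hq
  have hq0 : 0 ≤ q := by have := energyConst_nonneg ι a b; positivity
  set C₁ := √(b ^ 2 * Fintype.card ι * ((‖ζ 0‖ + 1) ^ 2 * (q * Real.exp q))) with hC₁
  -- The energy decays like e^{-δz}, and taking the square root halves the rate.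
  have hdecay : ∀ᶠ lam in 𝓝 (0 : ℂ), ∀ z, 0 ≤ z → ‖V lam z‖ ≤ C₁ * Real.exp (-(δ / 2) * z) := by
    filter_upwards [hF, hgood, hζb] with lam ⟨ℓ, w, θ, h1, h2⟩ ⟨h3, h4⟩ h5 z hz
    have h6 := norm_sq_le_of_tendsto_zero (h1.sub_smul (m lam)) (fun k => by simpa using h2 k)
      hr hδ (ε := ‖ζ 0‖ + 1) (h := fun z => R z (ζ lam)) (z := z) (fun s _ => hR s) (fun z _ => ?_) h3 h4
    · have h7 : Real.exp (q * Real.exp (-δ * z)) - 1 ≤ q * Real.exp q * Real.exp (-δ * z) :=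
        exp_mul_sub_one_le hq0 (Real.exp_nonneg _) (Real.exp_le_one_iff.2 (by nlinarith))
      have h8 : Real.exp (-δ * z) = Real.exp (-(δ / 2) * z) ^ 2 := by
        rw [← Real.exp_nat_mul]; congr 1; push_cast; ring
      refine le_of_sq_le_sq ?_ (by positivity)
      rw [mul_pow, hC₁, Real.sq_sqrt (by positivity), ← h8]
      refine h6.trans ?_
      calc _ ≤ b ^ 2 * Fintype.card ι * ((‖ζ 0‖ + 1) ^ 2 *
            (q * Real.exp q * Real.exp (-δ * z))) := by gcongr
        _ = _ := by ring
    · rw [mul_comm]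
      exact ((R z).le_opNorm _).trans (mul_le_mul (hR z) h5 (norm_nonneg _) (by positivity))
  obtain ⟨ℓ, w, θ, f1, f2⟩ := hF.self_of_nhds
  obtain ⟨g1, g2⟩ := hgood.self_of_nhds
  -- V λ - V 0 solves the equation for P 0 with forcing R(ζ λ - ζ 0) + (P λ - P 0) V λ. Lipschitz
  -- bounds on ζ and P, together with the decay of V λ, make it at most |λ| (r C₂ + C₃ C₁)
  -- e^{-δs/2}. The summand r lets r' bound R as well, so the Gronwall estimate applies with ε =
  -- |λ|.
  set r' := r + (r * C₂ + C₃ * C₁) with hr'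
  have hr'0 : 0 ≤ r' := by positivity
  set q' := energyConst ι a b * r' / (δ / 2) with hq'
  have hq'0 : 0 ≤ q' := by have := energyConst_nonneg ι a b; positivity
  set C₄ := √(b ^ 2 * Fintype.card ι * Real.exp q') with hC₄
  have hdiff : ∀ᶠ lam in 𝓝 (0 : ℂ), ∀ z, 0 ≤ z → ‖V lam z - V 0 z‖ ≤ C₄ * ‖lam‖ := by
    filter_upwards [hdecay, hgood, hC₂.bound, hC₃.bound] with lam h1 ⟨h2, h3⟩ h4 h5 z hz
    rw [sub_zero] at h4 h5
    have hexp : ∀ s : ℝ, 0 ≤ s → Real.exp (-δ * s) ≤ Real.exp (-(δ / 2) * s) := fun s hs =>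
      Real.exp_le_exp.2 (by nlinarith)
    have h6 := norm_sq_le_of_tendsto_zero (f1.sub_smul (m 0)) (fun k => by simpa using f2 k)
      hr'0 (half_pos hδ) (ε := ‖lam‖) (V := fun s => V lam s - V 0 s)
      (h := fun s => R s (ζ lam - ζ 0) + (P lam - P 0) (V lam s)) (z := z) (R := R)
      (fun s hs => ?_) (fun s hs => ?_) (fun s => ?_) (by simpa using h3.sub g2)
    · refine le_of_sq_le_sq ?_ (by positivity)
      rw [mul_pow, hC₄, Real.sq_sqrt (by positivity)]
      refine h6.trans ?_
      have h7 : Real.exp (q' * Real.exp (-(δ / 2) * z)) - 1 ≤ Real.exp q' := by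
        have : Real.exp (q' * Real.exp (-(δ / 2) * z)) ≤ Real.exp q' :=
          Real.exp_le_exp.2 (mul_le_of_le_one_right hq'0
            (Real.exp_le_one_iff.2 (by nlinarith)))
        linarith
      calc _ ≤ b ^ 2 * Fintype.card ι * (‖lam‖ ^ 2 * Real.exp q') := by gcongr
        _ = _ := by ring
    · refine (hR s).trans ?_
      have := hexp s (hz.trans hs)
      have : r ≤ r' := by rw [hr']; linarith [show 0 ≤ r * C₂ + C₃ * C₁ by positivity]
      gcongr
    · have e0 := hz.trans hs
      have e1 := hexp s e0
      have e2 : ‖R s (ζ lam - ζ 0)‖ ≤ r * Real.exp (-(δ / 2) * s) * (C₂ * ‖lam‖) :=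
        ((R s).le_opNorm _).trans (mul_le_mul ((hR s).trans (by gcongr)) h4 (norm_nonneg _)
          (by positivity))
      have e3 : ‖(P lam - P 0) (V lam s)‖ ≤ C₃ * ‖lam‖ * (C₁ * Real.exp (-(δ / 2) * s)) :=
        ((P lam - P 0).le_opNorm _).trans (mul_le_mul h5 (h1 s e0) (norm_nonneg _)
          (by positivity))
      calc _ ≤ r * Real.exp (-(δ / 2) * s) * (C₂ * ‖lam‖) +
            C₃ * ‖lam‖ * (C₁ * Real.exp (-(δ / 2) * s)) := (norm_add_le _ _).trans (add_le_add e2 e3)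
        _ = ‖lam‖ * ((r * C₂ + C₃ * C₁) * Real.exp (-(δ / 2) * s)) := by ring
        _ ≤ _ := by
          have : r * C₂ + C₃ * C₁ ≤ r' := by rw [hr']; linarith
          gcongr
    · refine ((h2 s).sub (g1 s)).congr_deriv ?_
      simp only [hP, map_sub, sub_apply]
      abel
  refine ⟨(C₁ + (‖ζ 0‖ + 1)) + (C₄ + C₂), ?_⟩
  filter_upwards [hdecay, hζb, hdiff, hC₂.bound] with lam h1 h2 h3 h4 z hz
  have e1 : Complex.exp (-m lam * z) • Z lam z = V lam z + ζ lam := by simp [hV]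
  have e2 : Complex.exp (-m 0 * z) • Z 0 z = V 0 z + ζ 0 := by simp [hV]
  have e3 : Real.exp (-(δ / 2) * z) ≤ 1 := Real.exp_le_one_iff.2 (by nlinarith)
  have hC₁0 : 0 ≤ C₁ := Real.sqrt_nonneg _
  have hC₄0 : 0 ≤ C₄ := Real.sqrt_nonneg _
  rw [sub_zero] at h4
  constructor
  · rw [e1]
    refine (norm_add_le _ _).trans ?_
    nlinarith [h1 z hz]
  · rw [e1, e2, add_sub_add_comm]
    refine (norm_add_le _ _).trans ?_
    have := mul_nonneg (add_nonneg hC₁0 (add_nonneg (norm_nonneg (ζ 0)) zero_le_one)) (norm_nonneg lam)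
    nlinarith [h3 z hz]

end Families

/-! ### Exterior algebra of K⁴ in coordinates -/

section Algebra

variable {K : Type*} [CommRing K]

theorem wedgeTwo_add_left (a a' b : Fin 4 → K) :
    wedgeTwo (a + a') b = wedgeTwo a b + wedgeTwo a' b := by
  funext k; simp only [wedgeTwo, Pi.add_apply]; ring

theorem wedgeTwo_add_right (a b b' : Fin 4 → K) :
    wedgeTwo a (b + b') = wedgeTwo a b + wedgeTwo a b' := by
  funext k; simp only [wedgeTwo, Pi.add_apply]; ring

theorem wedgeTwo_smul_left (t : K) (a b : Fin 4 → K) : wedgeTwo (t • a) b = t • wedgeTwo a b := by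
  funext k; simp only [wedgeTwo, Pi.smul_apply, smul_eq_mul]; ring

theorem wedgeTwo_smul_right (t : K) (a b : Fin 4 → K) :
    wedgeTwo a (t • b) = t • wedgeTwo a b := by
  funext k; simp only [wedgeTwo, Pi.smul_apply, smul_eq_mul]; ring

theorem wedgeFour_add_left (Z Z' W : Fin 6 → K) :
    wedgeFour (Z + Z') W = wedgeFour Z W + wedgeFour Z' W := by
  simp only [wedgeFour, Pi.add_apply]; ring

theorem wedgeFour_add_right (Z W W' : Fin 6 → K) :
    wedgeFour Z (W + W') = wedgeFour Z W + wedgeFour Z W' := by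
  simp only [wedgeFour, Pi.add_apply]; ring

theorem wedgeFour_sub_left (Z Z' W : Fin 6 → K) :
    wedgeFour (Z - Z') W = wedgeFour Z W - wedgeFour Z' W := by
  simp only [wedgeFour, Pi.sub_apply]; ring

theorem wedgeFour_sub_right (Z W W' : Fin 6 → K) :
    wedgeFour Z (W - W') = wedgeFour Z W - wedgeFour Z W' := by
  simp only [wedgeFour, Pi.sub_apply]; ring

theorem wedgeFour_smul_left (t : K) (Z W : Fin 6 → K) :
    wedgeFour (t • Z) W = t * wedgeFour Z W := by
  simp only [wedgeFour, Pi.smul_apply, smul_eq_mul]; ring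

theorem wedgeFour_smul_right (t : K) (Z W : Fin 6 → K) :
    wedgeFour Z (t • W) = t * wedgeFour Z W := by
  simp only [wedgeFour, Pi.smul_apply, smul_eq_mul]; ring

theorem induced_add (A : Matrix (Fin 4) (Fin 4) K) (Z W : Fin 6 → K) :
    induced A (Z + W) = induced A Z + induced A W := by
  simp only [induced, Pi.add_apply, add_smul, Finset.sum_add_distrib]

theorem induced_smul (A : Matrix (Fin 4) (Fin 4) K) (t : K) (Z : Fin 6 → K) :
    induced A (t • Z) = t • induced A Z := by
  simp only [induced, Pi.smul_apply, smul_assoc, Finset.smul_sum]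

theorem add_induced (A B : Matrix (Fin 4) (Fin 4) K) (Z : Fin 6 → K) :
    induced (A + B) Z = induced A Z + induced B Z := by
  simp only [induced, ← Finset.sum_add_distrib, ← smul_add, Matrix.add_mulVec, wedgeTwo_add_left,
    wedgeTwo_add_right]
  refine Finset.sum_congr rfl fun k _ => ?_
  congr 1
  abel

theorem smul_induced (t : K) (A : Matrix (Fin 4) (Fin 4) K) (Z : Fin 6 → K) :
    induced (t • A) Z = t • induced A Z := by
  simp only [induced, Finset.smul_sum, Matrix.smul_mulVec, wedgeTwo_smul_left,
    wedgeTwo_smul_right, ← smul_add]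
  refine Finset.sum_congr rfl fun k _ => ?_
  rw [smul_comm]

/-- A derivation acts on the top exterior power as multiplication by the trace. -/
theorem wedgeFour_induced (A : Matrix (Fin 4) (Fin 4) K) (Z W : Fin 6 → K) :
    wedgeFour (induced A Z) W + wedgeFour Z (induced A W) = A.trace * wedgeFour Z W := by
  simp [induced, wedgeTwo, wedgeFour, pairFst, pairSnd, Fin.sum_univ_succ,
    Pi.single_apply, Matrix.trace]
  ring

/-- Signs of the complementary pairs in the pairing `wedgeFour`. -/
def pairSign : Fin 6 → ℤ := ![1, -1, 1, 1, -1, 1]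

/-- Pairing with eᵢ ∧ eⱼ reads off the coefficient of the complementary two-vector, up to the sign
and det e. In the chosen order of pairs the complement of the k-th one is the `k.rev`-th. For a
basis of eigenvectors this supplies eigencoordinates on two-vectors. -/
theorem sum_wedgeFour_smul_wedgeTwo (e : Fin 4 → Fin 4 → K) (Z : Fin 6 → K) :
    ∑ k, wedgeFour Z (wedgeTwo (e (pairFst k)) (e (pairSnd k))) •
      (pairSign k • wedgeTwo (e (pairFst k.rev)) (e (pairSnd k.rev))) =
    (Matrix.of e).det • Z := by
  have h : (Matrix.of e).det = wedgeFour (wedgeTwo (e 0) (e 1)) (wedgeTwo (e 2) (e 3)) := by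
    rw [wedgeFour_wedgeTwo, Matrix.det_transpose]
    congr 1
    ext i j
    fin_cases i <;> rfl
  rw [h]
  funext j
  simp only [Fin.sum_univ_succ, Finset.univ_eq_empty, Finset.sum_empty, Pi.add_apply, Pi.smul_apply,
    smul_eq_mul, zsmul_eq_mul, Pi.mul_apply]
  fin_cases j <;> simp [pairSign, wedgeTwo, wedgeFour, pairFst, pairSnd, Fin.rev] <;> ring

end Algebra

/-! ### Eigenframes for `A` and its induced derivation -/

section Frames

/-- `induced A` as a continuous linear map. -/
def inducedCLM (A : Matrix (Fin 4) (Fin 4) ℂ) : (Fin 6 → ℂ) →L[ℂ] (Fin 6 → ℂ) :=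
  LinearMap.toContinuousLinearMap
    { toFun := induced A
      map_add' := induced_add A
      map_smul' := induced_smul A }

@[simp] theorem inducedCLM_apply (A : Matrix (Fin 4) (Fin 4) ℂ) (Z : Fin 6 → ℂ) :
    inducedCLM A Z = induced A Z := rfl

theorem inducedCLM_add (A B : Matrix (Fin 4) (Fin 4) ℂ) :
    inducedCLM (A + B) = inducedCLM A + inducedCLM B := by
  ext1 Z; exact add_induced A B Z

theorem inducedCLM_smul (t : ℂ) (A : Matrix (Fin 4) (Fin 4) ℂ) :
    inducedCLM (t • A) = t • inducedCLM A := by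
  ext1 Z; exact smul_induced t A Z

/-- `A` acting on column vectors as a continuous linear map. -/
def mulVecCLM {n : ℕ} (A : Matrix (Fin n) (Fin n) ℂ) : (Fin n → ℂ) →L[ℂ] (Fin n → ℂ) :=
  LinearMap.toContinuousLinearMap A.mulVecLin

@[simp] theorem mulVecCLM_apply {n : ℕ} (A : Matrix (Fin n) (Fin n) ℂ) (y : Fin n → ℂ) :
    mulVecCLM A y = A.mulVec y := rfl

/-- `Z ↦ Z ∧ W` as a continuous linear map. -/
def wedgeFourCLM (W : Fin 6 → ℂ) : (Fin 6 → ℂ) →L[ℂ] ℂ :=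
  LinearMap.toContinuousLinearMap
    { toFun := fun Z => wedgeFour Z W
      map_add' := fun Z Z' => wedgeFour_add_left Z Z' W
      map_smul' := fun t Z => wedgeFour_smul_left t Z W }

@[simp] theorem wedgeFourCLM_apply (W Z : Fin 6 → ℂ) : wedgeFourCLM W Z = wedgeFour Z W := rfl

theorem norm_wedgeTwo_le (a b : Fin 4 → ℂ) : ‖wedgeTwo a b‖ ≤ 2 * (‖a‖ * ‖b‖) := by
  refine (pi_norm_le_iff_of_nonneg (by positivity)).2 fun k => ?_
  refine (norm_sub_le _ _).trans ?_
  rw [norm_mul, norm_mul, two_mul]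
  gcongr <;> exact norm_le_pi_norm _ _

theorem norm_wedgeFour_le (Z W : Fin 6 → ℂ) : ‖wedgeFour Z W‖ ≤ 6 * (‖Z‖ * ‖W‖) := by
  have h : ∀ i j, ‖Z i * W j‖ ≤ ‖Z‖ * ‖W‖ := fun i j => by
    rw [norm_mul]
    gcongr <;> exact norm_le_pi_norm _ _
  unfold wedgeFour
  have e1 := norm_add_le (Z 0 * W 5 - Z 1 * W 4 + Z 2 * W 3 + Z 3 * W 2 - Z 4 * W 1) (Z 5 * W 0)
  have e2 := norm_sub_le (Z 0 * W 5 - Z 1 * W 4 + Z 2 * W 3 + Z 3 * W 2) (Z 4 * W 1)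
  have e3 := norm_add_le (Z 0 * W 5 - Z 1 * W 4 + Z 2 * W 3) (Z 3 * W 2)
  have e4 := norm_add_le (Z 0 * W 5 - Z 1 * W 4) (Z 2 * W 3)
  have e5 := norm_sub_le (Z 0 * W 5) (Z 1 * W 4)
  linarith [h 0 5, h 1 4, h 2 3, h 3 2, h 4 1, h 5 0]

theorem HasDerivAt.wedgeTwo {a b : ℝ → Fin 4 → ℂ} {a' b' : Fin 4 → ℂ} {z : ℝ}
    (ha : HasDerivAt a a' z) (hb : HasDerivAt b b' z) :
    HasDerivAt (fun z => wedgeTwo (a z) (b z))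
      (_root_.wedgeTwo a' (b z) + _root_.wedgeTwo (a z) b') z := by
  rw [hasDerivAt_pi] at ha hb ⊢
  intro k
  refine (((ha _).mul (hb _)).sub ((ha _).mul (hb _))).congr_deriv ?_
  simp only [_root_.wedgeTwo, Pi.add_apply]
  ring

theorem HasDerivAt.wedgeFour {Z W : ℝ → Fin 6 → ℂ} {Z' W' : Fin 6 → ℂ} {z : ℝ}
    (hZ : HasDerivAt Z Z' z) (hW : HasDerivAt W W' z) :
    HasDerivAt (fun z => wedgeFour (Z z) (W z))
      (_root_.wedgeFour Z' (W z) + _root_.wedgeFour (Z z) W') z := by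
  rw [hasDerivAt_pi] at hZ hW
  refine (((((((hZ 0).mul (hW 5)).sub ((hZ 1).mul (hW 4))).add ((hZ 2).mul (hW 3))).add
    ((hZ 3).mul (hW 2))).sub ((hZ 4).mul (hW 1))).add ((hZ 5).mul (hW 0))).congr_deriv ?_
  simp only [_root_.wedgeFour]
  ring

theorem continuous_wedgeFour {X : Type*} [TopologicalSpace X] {Z W : X → Fin 6 → ℂ}
    (hZ : Continuous Z) (hW : Continuous W) : Continuous fun x => wedgeFour (Z x) (W x) := by
  unfold wedgeFour; fun_prop

/-- The frame of two-vectors attached to a basis of eigenvectors of `A`. -/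
theorem isDiagonalFrame_inducedCLM {A : Matrix (Fin 4) (Fin 4) ℂ} {e : Fin 4 → Fin 4 → ℂ}
    {μ : Fin 4 → ℂ} (h : ∀ i, A.mulVec (e i) = μ i • e i) {M d : ℝ} (hM : ∀ i, ‖e i‖ ≤ M)
    (hd : 0 < d) (hdet : d ≤ ‖(Matrix.of e).det‖) :
    IsDiagonalFrame (inducedCLM A)
      (fun k => wedgeFourCLM (wedgeTwo (e (pairFst k)) (e (pairSnd k))))
      (fun k => (Matrix.of e).det⁻¹ •
        (pairSign k • wedgeTwo (e (pairFst k.rev)) (e (pairSnd k.rev))))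
      (fun k => A.trace - (μ (pairFst k) + μ (pairSnd k))) (12 * M ^ 2) (d⁻¹ * (2 * M ^ 2)) := by
  have hM0 : 0 ≤ M := (norm_nonneg _).trans (hM 0)
  have hw : ∀ i j, ‖wedgeTwo (e i) (e j)‖ ≤ 2 * M ^ 2 := fun i j => by
    refine (norm_wedgeTwo_le _ _).trans ?_
    rw [pow_two]
    gcongr
    exacts [hM i, hM j]
  have hdet0 : (Matrix.of e).det ≠ 0 := norm_pos_iff.1 (hd.trans_le hdet)
  refine ⟨fun k Z => ?_, fun Z => ?_, fun k => ?_, fun k => ?_⟩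
  · have h1 := wedgeFour_induced A Z (wedgeTwo (e (pairFst k)) (e (pairSnd k)))
    rw [induced_wedgeTwo, h, h, wedgeTwo_smul_left, wedgeTwo_smul_right, ← add_smul,
      wedgeFour_smul_right] at h1
    simp only [wedgeFourCLM_apply, inducedCLM_apply]
    linear_combination h1
  · have h1 := sum_wedgeFour_smul_wedgeTwo e Z
    simp only [wedgeFourCLM_apply]
    simp_rw [smul_comm _ ((Matrix.of e).det⁻¹)]
    rw [← Finset.smul_sum, h1, inv_smul_smul₀ hdet0]
  · refine ContinuousLinearMap.opNorm_le_bound _ (by positivity) fun Z => ?_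
    refine (norm_wedgeFour_le _ _).trans ?_
    have := hw (pairFst k) (pairSnd k)
    nlinarith [norm_nonneg Z]
  · rw [norm_smul, norm_inv]
    have h1 : ‖pairSign k • wedgeTwo (e (pairFst k.rev)) (e (pairSnd k.rev))‖ ≤ 2 * M ^ 2 := by
      refine le_trans (le_of_eq ?_) (hw (pairFst k.rev) (pairSnd k.rev))
      fin_cases k <;> simp [pairSign]
    gcongr

/-- The frame attached to a basis of eigenvectors of `A`. -/
theorem exists_isDiagonalFrame_mulVecCLM {n : ℕ} {A : Matrix (Fin n) (Fin n) ℂ}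
    {e : Fin n → Fin n → ℂ} {μ : Fin n → ℂ} (h : ∀ i, A.mulVec (e i) = μ i • e i)
    (hdet : (Matrix.of e).det ≠ 0) :
    ∃ (ℓ : Fin n → (Fin n → ℂ) →L[ℂ] ℂ) (a b : ℝ), IsDiagonalFrame (mulVecCLM A) ℓ e μ a b := by
  set T := (Matrix.of e).transpose with hT
  have hdT : IsUnit T.det := by rw [hT, Matrix.det_transpose]; exact hdet.isUnit
  -- The columns of T are the eigenvectors, so the rows of T⁻¹ are left eigenvectors of A; they
  -- serve as the coordinates.
  have hAT : A * T = T * Matrix.diagonal μ := by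
    ext i j
    rw [Matrix.mul_diagonal]
    have := congrFun (h j) i
    simpa [Matrix.mul_apply, Matrix.mulVec, dotProduct, hT, mul_comm] using this
  have hTA : T⁻¹ * A = Matrix.diagonal μ * T⁻¹ := by
    have h1 : T⁻¹ * (A * T) * T⁻¹ = T⁻¹ * (T * Matrix.diagonal μ) * T⁻¹ := by rw [hAT]
    rwa [← Matrix.mul_assoc, Matrix.mul_assoc, Matrix.mul_nonsing_inv _ hdT, Matrix.mul_one,
      ← Matrix.mul_assoc, Matrix.nonsing_inv_mul _ hdT, Matrix.one_mul] at h1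
  refine ⟨fun i => (ContinuousLinearMap.proj i).comp (mulVecCLM T⁻¹),
    ∑ i, ‖(ContinuousLinearMap.proj i : (Fin n → ℂ) →L[ℂ] ℂ).comp (mulVecCLM T⁻¹)‖,
    ∑ i, ‖e i‖, fun i y => ?_, fun y => ?_, fun i => ?_, fun i => ?_⟩
  · simp only [ContinuousLinearMap.comp_apply, mulVecCLM_apply, ContinuousLinearMap.proj_apply,
      Matrix.mulVec_mulVec, hTA]
    rw [← Matrix.mulVec_mulVec, Matrix.mulVec_diagonal]
  · simp only [ContinuousLinearMap.comp_apply, mulVecCLM_apply, ContinuousLinearMap.proj_apply]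
    have h1 : y = T.mulVec (T⁻¹.mulVec y) := by
      rw [Matrix.mulVec_mulVec, Matrix.mul_nonsing_inv _ hdT, Matrix.one_mulVec]
    conv_lhs => rw [h1]
    ext j
    simp [Matrix.mulVec, dotProduct, hT, mul_comm]
  · exact Finset.single_le_sum (f := fun i =>
      ‖(ContinuousLinearMap.proj i : (Fin n → ℂ) →L[ℂ] ℂ).comp (mulVecCLM T⁻¹)‖)
      (fun _ _ => norm_nonneg _) (Finset.mem_univ i)
  · exact Finset.single_le_sum (f := fun i => ‖e i‖) (fun _ _ => norm_nonneg _) (Finset.mem_univ i)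

end Frames

/-! ### Spatial eigenvalues and eigenvectors of the rest state -/

section Spectrum

theorem rateMinus_add_ratePlus (c ν : ℝ) : rateMinus c ν + ratePlus c ν = -c := by
  unfold rateMinus ratePlus; ring

theorem muMinus_add_muPlus (c ν : ℝ) (lam : ℂ) : muMinus c ν lam + muPlus c ν lam = -c := by
  unfold muMinus muPlus; ring

theorem rateMinus_lt_rateMinus {c ν₁ ν₂ : ℝ} (h : ν₁ < ν₂) (h₂ : ν₂ < 0) :
    rateMinus c ν₁ < rateMinus c ν₂ := by
  unfold rateMinus
  have : √(c ^ 2 - 4 * ν₂) < √(c ^ 2 - 4 * ν₁) :=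
    Real.sqrt_lt_sqrt (by nlinarith [sq_nonneg c]) (by linarith)
  linarith

theorem ratePlus_lt_ratePlus {c ν₁ ν₂ : ℝ} (h : ν₁ < ν₂) (h₂ : ν₂ < 0) :
    ratePlus c ν₂ < ratePlus c ν₁ := by
  have h1 := rateMinus_lt_rateMinus (c := c) h h₂
  linarith [rateMinus_add_ratePlus c ν₁, rateMinus_add_ratePlus c ν₂]

theorem abs_lt_sqrt_of_neg {c ν : ℝ} (h : ν < 0) : |c| < √(c ^ 2 - 4 * ν) := by
  rw [← Real.sqrt_sq_eq_abs]
  exact Real.sqrt_lt_sqrt (sq_nonneg c) (by linarith)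

theorem rateMinus_neg {c ν : ℝ} (h : ν < 0) : rateMinus c ν < 0 := by
  unfold rateMinus; linarith [abs_lt_sqrt_of_neg (c := c) h, neg_abs_le c]

theorem ratePlus_pos {c ν : ℝ} (h : ν < 0) : 0 < ratePlus c ν := by
  unfold ratePlus; linarith [abs_lt_sqrt_of_neg (c := c) h, le_abs_self c]

theorem cpow_half_sq (x : ℂ) : (x ^ (1 / 2 : ℂ)) ^ 2 = x := by
  rw [← Complex.cpow_nat_mul]; norm_num

theorem muMinus_quadratic (c ν : ℝ) (lam : ℂ) :
    muMinus c ν lam ^ 2 + c * muMinus c ν lam = lam - ν := by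
  have := cpow_half_sq ((c : ℂ) ^ 2 + 4 * (lam - (ν : ℂ)))
  unfold muMinus
  linear_combination this / 4

theorem muPlus_quadratic (c ν : ℝ) (lam : ℂ) :
    muPlus c ν lam ^ 2 + c * muPlus c ν lam = lam - ν := by
  have := cpow_half_sq ((c : ℂ) ^ 2 + 4 * (lam - (ν : ℂ)))
  unfold muPlus
  linear_combination this / 4

theorem differentiableAt_cpow_half {c ν : ℝ} (h : ν < 0) :
    DifferentiableAt ℂ (fun lam : ℂ => ((c : ℂ) ^ 2 + 4 * (lam - (ν : ℂ))) ^ (1 / 2 : ℂ)) 0 := by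
  refine DifferentiableAt.cpow_const (by fun_prop) ?_
  left
  have : ((c : ℂ) ^ 2 + 4 * (0 - (ν : ℂ))).re = c ^ 2 - 4 * ν := by
    have : (c : ℂ) ^ 2 + 4 * (0 - (ν : ℂ)) = ((c ^ 2 - 4 * ν : ℝ) : ℂ) := by push_cast; ring
    rw [this, Complex.ofReal_re]
  rw [this]
  nlinarith [sq_nonneg c]

theorem differentiableAt_muMinus {c ν : ℝ} (h : ν < 0) :
    DifferentiableAt ℂ (muMinus c ν) 0 :=
  ((differentiableAt_cpow_half h).div_const 2).const_sub _

theorem differentiableAt_muPlus {c ν : ℝ} (h : ν < 0) :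
    DifferentiableAt ℂ (muPlus c ν) 0 :=
  ((differentiableAt_cpow_half h).div_const 2).const_add _

theorem charpoly_eq_zero {f g : ℝ → ℝ} {σ α ν : ℝ} (hσ : 0 < σ)
    (h : Module.End.HasEigenvalue (Matrix.toLin' (kineticsJacobian f g σ α)) ν) :
    (deriv f 0 - ν) * (deriv g 0 - ν) + σ * α = 0 := by
  obtain ⟨v, hv⟩ := h.exists_hasEigenvector
  have h1 := hv.apply_eq_smul
  have e0 := congrFun h1 0
  have e1 := congrFun h1 1
  simp [kineticsJacobian, Matrix.mulVec, dotProduct, Fin.sum_univ_succ] at e0 e1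
  have hv0 : v 0 ≠ 0 := fun h0 => by
    refine hv.2 (funext fun i => ?_)
    rw [h0] at e0
    have : v 1 = 0 := by
      have : σ * v 1 = 0 := by linarith
      exact (mul_eq_zero.1 this).resolve_left hσ.ne'
    fin_cases i
    exacts [h0, this]
  refine (mul_eq_zero.1 (?_ : _ * v 0 = 0)).resolve_right hv0
  linear_combination σ * e1 + (deriv g 0 - ν) * e0

/-- The eigenvector of the asymptotic coefficient matrix for the eigenvalue `μ`. -/
def eigvec (σ α κ μ : ℂ) : Fin 4 → ℂ := ![σ, κ, μ, μ * κ / α]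

theorem coeffMatrix_mulVec_eigvec {σ α c a b lam ν μ : ℂ} (hσ : σ ≠ 0) (hα : α ≠ 0)
    (hν : (a - ν) * (b - ν) + σ * α = 0) (hμ : μ ^ 2 + c * μ = lam - ν) :
    (coeffMatrix σ α c a b lam).mulVec (eigvec σ α (a - ν) μ) = μ • eigvec σ α (a - ν) μ := by
  funext i
  fin_cases i <;> simp [coeffMatrix, eigvec, Matrix.mulVec, dotProduct, Fin.sum_univ_succ]
  · ring
  · field_simp
  · field_simp
    linear_combination -hμ
  · field_simp
    linear_combination -(a - ν) * hμ - hν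

theorem trace_coeffMatrix {σ α c a b lam : ℂ} : (coeffMatrix σ α c a b lam).trace = -2 * c := by
  simp [coeffMatrix, Matrix.trace, Fin.sum_univ_succ]; ring

/-- The factorization shows that the eigenvectors are independent when the two kinetic eigenvalues
differ and each one yields two distinct rates. -/
theorem det_eigvec (σ α κ₁ κ₂ m₁ m₂ m₃ m₄ : ℂ) :
    (Matrix.of ![eigvec σ α κ₁ m₁, eigvec σ α κ₂ m₂, eigvec σ α κ₂ m₃, eigvec σ α κ₁ m₄]).det =
      -(σ * (κ₂ - κ₁) ^ 2 * (m₄ - m₁) * (m₃ - m₂) / α) := by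
  simp [eigvec, Matrix.det_succ_row_zero, Fin.sum_univ_succ, Fin.succAbove]
  ring

/-- The four spatial eigenvalues, in increasing order. -/
def mus (c ν₁ ν₂ : ℝ) (lam : ℂ) : Fin 4 → ℂ :=
  ![muMinus c ν₁ lam, muMinus c ν₂ lam, muPlus c ν₂ lam, muPlus c ν₁ lam]

/-- The eigenvectors for `mus`. -/
def eigenbasis (f : ℝ → ℝ) (σ α c ν₁ ν₂ : ℝ) (lam : ℂ) : Fin 4 → Fin 4 → ℂ :=
  ![eigvec σ α ((deriv f 0 : ℝ) - ν₁) (muMinus c ν₁ lam),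
    eigvec σ α ((deriv f 0 : ℝ) - ν₂) (muMinus c ν₂ lam),
    eigvec σ α ((deriv f 0 : ℝ) - ν₂) (muPlus c ν₂ lam),
    eigvec σ α ((deriv f 0 : ℝ) - ν₁) (muPlus c ν₁ lam)]

variable {f g : ℝ → ℝ} {σ α c ν₁ ν₂ : ℝ} {uh vh : ℝ → ℝ}

theorem IsTravelingWave.mulVec_eigenbasis (hw : IsTravelingWave f g σ α c ν₁ ν₂ uh vh) (lam : ℂ)
    (i : Fin 4) : (matrixAInfty f g σ α c lam).mulVec (eigenbasis f σ α c ν₁ ν₂ lam i) =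
      mus c ν₁ ν₂ lam i • eigenbasis f σ α c ν₁ ν₂ lam i := by
  have hσ : (σ : ℂ) ≠ 0 := Complex.ofReal_ne_zero.2 hw.sigma_pos.ne'
  have hα : (α : ℂ) ≠ 0 := Complex.ofReal_ne_zero.2 hw.alpha_pos.ne'
  have h1 : (((deriv f 0 : ℝ) : ℂ) - ν₁) * (((deriv g 0 : ℝ) : ℂ) - ν₁) + σ * α = 0 := by
    exact_mod_cast charpoly_eq_zero hw.sigma_pos hw.eigenvalue_one
  have h2 : (((deriv f 0 : ℝ) : ℂ) - ν₂) * (((deriv g 0 : ℝ) : ℂ) - ν₂) + σ * α = 0 := by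
    exact_mod_cast charpoly_eq_zero hw.sigma_pos hw.eigenvalue_two
  fin_cases i
  exacts [coeffMatrix_mulVec_eigvec hσ hα h1 (muMinus_quadratic c ν₁ lam),
    coeffMatrix_mulVec_eigvec hσ hα h2 (muMinus_quadratic c ν₂ lam),
    coeffMatrix_mulVec_eigvec hσ hα h2 (muPlus_quadratic c ν₂ lam),
    coeffMatrix_mulVec_eigvec hσ hα h1 (muPlus_quadratic c ν₁ lam)]

theorem IsTravelingWave.det_eigenbasis_ne_zero (hw : IsTravelingWave f g σ α c ν₁ ν₂ uh vh) :
    (Matrix.of (eigenbasis f σ α c ν₁ ν₂ 0)).det ≠ 0 := by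
  have h2 := hw.eigenvalue_neg
  have h1 := hw.eigenvalue_lt.trans h2
  have hσ := hw.sigma_pos
  have hα := hw.alpha_pos
  rw [eigenbasis, det_eigvec, muMinus_zero c ν₁ h1.le, muMinus_zero c ν₂ h2.le,
    muPlus_zero c ν₁ h1.le, muPlus_zero c ν₂ h2.le]
  have e1 : 0 < ratePlus c ν₁ - rateMinus c ν₁ :=
    sub_pos.2 ((rateMinus_neg h1).trans (ratePlus_pos h1))
  have e2 : 0 < ratePlus c ν₂ - rateMinus c ν₂ :=
    sub_pos.2 ((rateMinus_neg h2).trans (ratePlus_pos h2))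
  have e3 : (deriv f 0 - ν₂ - (deriv f 0 - ν₁)) ≠ 0 := by
    have := hw.eigenvalue_lt
    intro h
    linarith
  have : σ * (deriv f 0 - ν₂ - (deriv f 0 - ν₁)) ^ 2 * (ratePlus c ν₁ - rateMinus c ν₁) *
      (ratePlus c ν₂ - rateMinus c ν₂) / α ≠ 0 := by positivity
  rw [neg_ne_zero]
  exact_mod_cast this

theorem IsTravelingWave.continuousAt_eigenbasis (hw : IsTravelingWave f g σ α c ν₁ ν₂ uh vh) :
    ContinuousAt (eigenbasis f σ α c ν₁ ν₂) 0 := by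
  have h2 := hw.eigenvalue_neg
  have h1 := hw.eigenvalue_lt.trans h2
  have a1 := (differentiableAt_muMinus (c := c) h1).continuousAt
  have a2 := (differentiableAt_muMinus (c := c) h2).continuousAt
  have a3 := (differentiableAt_muPlus (c := c) h2).continuousAt
  have a4 := (differentiableAt_muPlus (c := c) h1).continuousAt
  refine continuousAt_pi.2 fun i => continuousAt_pi.2 fun j => ?_
  fin_cases i <;> fin_cases j <;> simp [eigenbasis, eigvec] <;> fun_prop

/-- Near `λ = 0` the spatial eigenvalues are strictly ordered by their real parts. -/
theorem IsTravelingWave.eventually_mus_lt (hw : IsTravelingWave f g σ α c ν₁ ν₂ uh vh) :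
    ∀ᶠ lam in 𝓝 (0 : ℂ), (muMinus c ν₁ lam).re < (muMinus c ν₂ lam).re ∧
      (muMinus c ν₂ lam).re < (muPlus c ν₂ lam).re ∧
      (muPlus c ν₂ lam).re < (muPlus c ν₁ lam).re := by
  have h2 := hw.eigenvalue_neg
  have h1 := hw.eigenvalue_lt.trans h2
  have a1 := Complex.continuous_re.continuousAt.comp (differentiableAt_muMinus (c := c) h1).continuousAt
  have a2 := Complex.continuous_re.continuousAt.comp (differentiableAt_muMinus (c := c) h2).continuousAt
  have a3 := Complex.continuous_re.continuousAt.comp (differentiableAt_muPlus (c := c) h2).continuousAt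
  have a4 := Complex.continuous_re.continuousAt.comp (differentiableAt_muPlus (c := c) h1).continuousAt
  refine (a1.eventually_lt a2 ?_).and ((a2.eventually_lt a3 ?_).and (a3.eventually_lt a4 ?_)) <;>
    simp only [Function.comp, muMinus_zero c ν₁ h1.le, muMinus_zero c ν₂ h2.le,
      muPlus_zero c ν₁ h1.le, muPlus_zero c ν₂ h2.le, Complex.ofReal_re]
  exacts [rateMinus_lt_rateMinus hw.eigenvalue_lt h2, (rateMinus_neg h2).trans (ratePlus_pos h2),
    ratePlus_lt_ratePlus hw.eigenvalue_lt h2]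

/-- Near `λ = 0` the induced asymptotic matrix is diagonal in a uniformly bounded frame, with
extreme eigenvalues `μ₁ + μ₂` and `μ₃ + μ₄`. -/
theorem IsTravelingWave.exists_frame (hw : IsTravelingWave f g σ α c ν₁ ν₂ uh vh) :
    ∃ a b : ℝ, ∀ᶠ lam in 𝓝 (0 : ℂ), ∃ (ℓ : Fin 6 → (Fin 6 → ℂ) →L[ℂ] ℂ) (w : Fin 6 → Fin 6 → ℂ)
      (θ : Fin 6 → ℂ), IsDiagonalFrame (inducedCLM (matrixAInfty f g σ α c lam)) ℓ w θ a b ∧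
      (∀ k, (muMinus c ν₁ lam + muMinus c ν₂ lam).re ≤ (θ k).re) ∧
      ∀ k, (θ k).re ≤ (muPlus c ν₂ lam + muPlus c ν₁ lam).re := by
  have hc := hw.continuousAt_eigenbasis
  have hd := norm_pos_iff.2 hw.det_eigenbasis_ne_zero
  set d := ‖(Matrix.of (eigenbasis f σ α c ν₁ ν₂ 0)).det‖
  set M := ‖eigenbasis f σ α c ν₁ ν₂ 0‖ + 1
  have hM : ∀ᶠ lam in 𝓝 (0 : ℂ), ‖eigenbasis f σ α c ν₁ ν₂ lam‖ < M :=
    hc.norm.eventually (eventually_lt_nhds (lt_add_one _))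
  have hD : ∀ᶠ lam in 𝓝 (0 : ℂ), d / 2 < ‖(Matrix.of (eigenbasis f σ α c ν₁ ν₂ lam)).det‖ := by
    have hdet : Continuous fun e : Fin 4 → Fin 4 → ℂ => (Matrix.of e).det :=
      Continuous.matrix_det continuous_id
    exact (hdet.continuousAt.comp hc).norm.eventually (eventually_gt_nhds (half_lt_self hd))
  -- By continuity the eigenvectors stay below M and their determinant above d/2 near λ = 0, which
  -- makes the frame bounds uniform in λ.
  refine ⟨12 * M ^ 2, (d / 2)⁻¹ * (2 * M ^ 2), ?_⟩
  filter_upwards [hM, hD, hw.eventually_mus_lt] with lam h1 h2 ⟨h3, h4, h5⟩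
  refine ⟨_, _, _, isDiagonalFrame_inducedCLM (hw.mulVec_eigenbasis lam)
    (fun i => (norm_le_pi_norm _ i).trans h1.le) (half_pos hd) h2.le, ?_, ?_⟩
  all_goals
    have e1 := congrArg Complex.re (muMinus_add_muPlus c ν₁ lam)
    have e2 := congrArg Complex.re (muMinus_add_muPlus c ν₂ lam)
    simp only [Complex.add_re, Complex.neg_re, Complex.ofReal_re] at e1 e2
    intro k
    -- The trace -2c is the sum of all four rates, so each θₖ is the sum of the pair complementary
    -- to the k-th.
    rw [matrixAInfty, trace_coeffMatrix]
    fin_cases k <;> simp [mus, pairFst, pairSnd] <;> linarith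

end Spectrum

/-! ### Decay of the wave and the variational equation -/

section Wave

theorem exists_norm_le_of_tendsto_atTop {E : Type*} [NormedAddCommGroup E] {F : ℝ → E} {l : E}
    (hF : Continuous F) (h : Tendsto F atTop (𝓝 l)) : ∃ C, ∀ z, 0 ≤ z → ‖F z‖ ≤ C := by
  obtain ⟨T, hT⟩ := eventually_atTop.1 (h.norm.eventually (eventually_lt_nhds (lt_add_one ‖l‖)))
  obtain ⟨C, hC⟩ := (isCompact_Icc (a := (0 : ℝ)) (b := T)).exists_bound_of_continuousOn
    hF.continuousOn
  refine ⟨max C (‖l‖ + 1), fun z hz => ?_⟩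
  rcases le_total z T with h1 | h1
  · exact (hC z ⟨hz, h1⟩).trans (le_max_left _ _)
  · exact (hT z h1).le.trans (le_max_right _ _)

theorem ContDiff.exists_abs_sub_le {h : ℝ → ℝ} (hh : ContDiff ℝ 1 h) (M : ℝ) :
    ∃ L, 0 ≤ L ∧ ∀ x, |x| ≤ M → |h x - h 0| ≤ L * |x| := by
  obtain ⟨C, hC⟩ := (isCompact_Icc (a := -M) (b := M)).exists_bound_of_continuousOn
    (hh.continuous_deriv le_rfl).continuousOn
  refine ⟨|C|, abs_nonneg C, fun x hx => ?_⟩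
  have hM : 0 ≤ M := (abs_nonneg x).trans hx
  simpa using (convex_Icc (-M) M).norm_image_sub_le_of_norm_deriv_le
    (fun y _ => hh.differentiable one_ne_zero y) (fun y hy => (hC y hy).trans (le_abs_self C))
    (x := 0) (y := x) (by simpa using hM) (abs_le.1 hx)

variable {f g : ℝ → ℝ} {σ α c ν₁ ν₂ : ℝ} {uh vh : ℝ → ℝ}

theorem IsTravelingWave.continuous_profile (hw : IsTravelingWave f g σ α c ν₁ ν₂ uh vh) :
    Continuous (profile σ α uh vh) := by
  have h1 := hw.contDiff_u.continuous
  have h2 := hw.contDiff_v.continuous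
  have h3 := hw.contDiff_u.continuous_deriv one_le_two
  have h4 := hw.contDiff_v.continuous_deriv one_le_two
  refine continuous_pi fun i => ?_
  fin_cases i <;> simp [profile] <;> fun_prop

theorem norm_le_mul_exp {E : Type*} [NormedAddCommGroup E] [NormedSpace ℝ E] {x : E} {μ z C : ℝ}
    (h : ‖Real.exp (-μ * z) • x‖ ≤ C) : ‖x‖ ≤ C * Real.exp (μ * z) := by
  rw [norm_smul, Real.norm_eq_abs, Real.abs_exp] at h
  calc ‖x‖ = Real.exp (-μ * z) * ‖x‖ * Real.exp (μ * z) := by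
        rw [mul_right_comm, ← Real.exp_add]; simp
    _ ≤ _ := by gcongr

/-- Each exponential bound is genuine at one end only; at the other end the exponential is at least
1 and boundedness is enough. Both therefore hold on the whole line with one constant. -/
theorem IsTravelingWave.exists_profile_bound (hw : IsTravelingWave f g σ α c ν₁ ν₂ uh vh) :
    ∃ C, 0 ≤ C ∧ ∀ z, ‖profile σ α uh vh z‖ ≤ C ∧
      ‖profile σ α uh vh z‖ ≤ C * Real.exp (rateMinus c ν₂ * z) ∧
      ‖profile σ α uh vh z‖ ≤ C * Real.exp (ratePlus c ν₂ * z) := by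
  have hm := rateMinus_neg (c := c) hw.eigenvalue_neg
  have hp := ratePlus_pos (c := c) hw.eigenvalue_neg
  have hc := hw.continuous_profile
  obtain ⟨χ, -, hχ⟩ := hw.decay_forward
  obtain ⟨χ', -, hχ'⟩ := hw.decay_backward
  obtain ⟨C, hC⟩ := exists_norm_le_of_tendsto_atTop (by fun_prop) hχ
  obtain ⟨C', hC'⟩ := exists_norm_le_of_tendsto_atTop (by fun_prop)
    (hχ'.comp tendsto_neg_atTop_atBot)
  have hC0 : 0 ≤ C := (norm_nonneg _).trans (hC 0 le_rfl)
  have hC'0 : 0 ≤ C' := (norm_nonneg _).trans (hC' 0 le_rfl)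
  refine ⟨max C C', le_max_of_le_left hC0, fun z => ?_⟩
  rcases le_total 0 z with hz | hz
  · have h1 := norm_le_mul_exp (hC z hz)
    have h2 : Real.exp (rateMinus c ν₂ * z) ≤ 1 := Real.exp_le_one_iff.2 (by nlinarith)
    have h3 : 1 ≤ Real.exp (ratePlus c ν₂ * z) := Real.one_le_exp (by positivity)
    have h4 := le_max_left C C'
    have h5 := h1.trans (mul_le_of_le_one_right hC0 h2)
    exact ⟨h5.trans h4, h1.trans (by gcongr), (h5.trans h4).trans
      (le_mul_of_one_le_right (hC0.trans h4) h3)⟩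
  · have h0 := hC' (-z) (by linarith)
    simp only [Function.comp, neg_neg] at h0
    have h1 := norm_le_mul_exp h0
    have h2 : Real.exp (ratePlus c ν₂ * z) ≤ 1 := Real.exp_le_one_iff.2 (by nlinarith)
    have h3 : 1 ≤ Real.exp (rateMinus c ν₂ * z) := Real.one_le_exp (by nlinarith)
    have h4 := le_max_right C C'
    have h5 := h1.trans (mul_le_of_le_one_right hC'0 h2)
    exact ⟨h5.trans h4, (h5.trans h4).trans (le_mul_of_one_le_right (hC'0.trans h4) h3),
      h1.trans (by gcongr)⟩

/-- On the bounded range of the wave f, g, f', g' are Lipschitz, and the second derivatives in φ'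
are expressed through the wave equations, with f(0) = g(0) = 0. All these quantities thus inherit
the decay of φ. -/
theorem IsTravelingWave.exists_le_profile (hw : IsTravelingWave f g σ α c ν₁ ν₂ uh vh) :
    ∃ C, 0 ≤ C ∧ ∀ z, |deriv f (uh z) - deriv f 0| ≤ C * ‖profile σ α uh vh z‖ ∧
      |deriv g (vh z) - deriv g 0| ≤ C * ‖profile σ α uh vh z‖ ∧
      ‖profileDeriv σ α uh vh z‖ ≤ C * ‖profile σ α uh vh z‖ := by
  have hσ := hw.sigma_pos
  have hα := hw.alpha_pos
  obtain ⟨M, -, hM⟩ := hw.exists_profile_bound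
  have hf' : ContDiff ℝ 1 (deriv f) := (contDiff_succ_iff_deriv (n := 1)).1 hw.contDiff_f |>.2.2
  have hg' : ContDiff ℝ 1 (deriv g) := (contDiff_succ_iff_deriv (n := 1)).1 hw.contDiff_g |>.2.2
  obtain ⟨L₁, hL₁, h₁⟩ := hf'.exists_abs_sub_le M
  obtain ⟨L₂, hL₂, h₂⟩ := hg'.exists_abs_sub_le M
  obtain ⟨L₃, hL₃, h₃⟩ := (hw.contDiff_f.of_le one_le_two).exists_abs_sub_le M
  obtain ⟨L₄, hL₄, h₄⟩ := (hw.contDiff_g.of_le one_le_two).exists_abs_sub_le M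
  refine ⟨L₁ + L₂ + (σ + α) + (|c| + L₃ / σ + 1) + (|c| + L₄ / α + 1), by positivity,
    fun z => ?_⟩
  set p := ‖profile σ α uh vh z‖ with hp
  have hp0 : 0 ≤ p := norm_nonneg _
  have i0 : |uh z| ≤ p := norm_le_pi_norm (profile σ α uh vh z) 0
  have i1 : |vh z| ≤ p := norm_le_pi_norm (profile σ α uh vh z) 1
  have i2 : |deriv uh z / σ| ≤ p := norm_le_pi_norm (profile σ α uh vh z) 2
  have i3 : |deriv vh z / α| ≤ p := norm_le_pi_norm (profile σ α uh vh z) 3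
  have hpM := (hM z).1
  have j1 := h₁ _ (i0.trans hpM)
  have j2 := h₂ _ (i1.trans hpM)
  have j3 := h₃ _ (i0.trans hpM)
  have j4 := h₄ _ (i1.trans hpM)
  rw [hw.f_zero, sub_zero] at j3
  rw [hw.g_zero, sub_zero] at j4
  have k1 := mul_le_mul_of_nonneg_left i0 hL₁
  have k2 := mul_le_mul_of_nonneg_left i1 hL₂
  have k3 := mul_le_mul_of_nonneg_left i0 hL₃
  have k4 := mul_le_mul_of_nonneg_left i1 hL₄
  have t1 : 0 ≤ L₁ * p := by positivity
  have t2 : 0 ≤ L₂ * p := by positivity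
  have t3 : 0 ≤ σ * p := by positivity
  have t4 : 0 ≤ α * p := by positivity
  have t5 : 0 ≤ (|c| + L₃ / σ + 1) * p := by positivity
  have t6 : 0 ≤ (|c| + L₄ / α + 1) * p := by positivity
  have d1 : |deriv uh z| ≤ σ * p := by
    rw [abs_div, abs_of_pos hσ, div_le_iff₀ hσ] at i2; linarith
  have d2 : |deriv vh z| ≤ α * p := by
    rw [abs_div, abs_of_pos hα, div_le_iff₀ hα] at i3; linarith
  have d3 : |deriv (deriv uh) z / σ| ≤ (|c| + L₃ / σ + 1) * p := by
    have e : deriv (deriv uh) z / σ = -c * (deriv uh z / σ) + -(f (uh z) / σ) + vh z := by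
      have := hw.wave_u z
      field_simp
      linarith
    rw [e]
    refine (abs_add_three _ _ _).trans ?_
    have e2 : |f (uh z) / σ| ≤ L₃ / σ * p := by
      rw [abs_div, abs_of_pos hσ, div_mul_eq_mul_div]
      gcongr
      linarith
    rw [abs_mul, abs_neg, abs_neg]
    have := mul_le_mul_of_nonneg_left i2 (abs_nonneg c)
    linarith
  have d4 : |deriv (deriv vh) z / α| ≤ (|c| + L₄ / α + 1) * p := by
    have e : deriv (deriv vh) z / α = -c * (deriv vh z / α) + -(g (vh z) / α) + -uh z := by
      have := hw.wave_v z
      field_simp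
      linarith
    rw [e]
    refine (abs_add_three _ _ _).trans ?_
    have e2 : |g (vh z) / α| ≤ L₄ / α * p := by
      rw [abs_div, abs_of_pos hα, div_mul_eq_mul_div]
      gcongr
      linarith
    rw [abs_mul, abs_neg, abs_neg, abs_neg]
    have := mul_le_mul_of_nonneg_left i3 (abs_nonneg c)
    linarith
  refine ⟨by linarith, by linarith, (pi_norm_le_iff_of_nonneg (by positivity)).2 fun i => ?_⟩
  fin_cases i <;> simp only [profileDeriv, Real.norm_eq_abs, Fin.zero_eta, Fin.mk_one,
    Fin.reduceFinMk, Matrix.cons_val]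
  · linarith
  · linarith
  · linarith
  · linarith

/-- The coefficients approach their limits, and `φ'` vanishes, at the rate of the leading
exponential at either end. -/
theorem IsTravelingWave.exists_decay (hw : IsTravelingWave f g σ α c ν₁ ν₂ uh vh) :
    ∃ C, 0 ≤ C ∧ ∀ z, ∀ μ ∈ ({rateMinus c ν₂, ratePlus c ν₂} : Set ℝ),
      |deriv f (uh z) - deriv f 0| ≤ C * Real.exp (μ * z) ∧
      |deriv g (vh z) - deriv g 0| ≤ C * Real.exp (μ * z) ∧
      ‖profileDeriv σ α uh vh z‖ ≤ C * Real.exp (μ * z) := by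
  obtain ⟨C, hC0, hC⟩ := hw.exists_profile_bound
  obtain ⟨K, hK0, hK⟩ := hw.exists_le_profile
  refine ⟨K * C, by positivity, fun z μ hμ => ?_⟩
  have h : K * ‖profile σ α uh vh z‖ ≤ K * C * Real.exp (μ * z) := by
    rw [mul_assoc]
    rcases hμ with rfl | rfl
    · exact mul_le_mul_of_nonneg_left (hC z).2.1 hK0
    · exact mul_le_mul_of_nonneg_left (hC z).2.2 hK0
  exact ⟨(hK z).1.trans h, (hK z).2.1.trans h, (hK z).2.2.trans h⟩

/-- The translation mode solves the linearization at λ = 0. The third derivatives of û and v̂ exist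
because the wave equations express the second ones through C¹ functions. -/
theorem IsTravelingWave.hasDerivAt_profileDeriv (hw : IsTravelingWave f g σ α c ν₁ ν₂ uh vh)
    (z : ℝ) : HasDerivAt (profileDeriv σ α uh vh)
      ((realMatrix f g σ α c uh vh z).mulVec (profileDeriv σ α uh vh z)) z := by
  have hσ := hw.sigma_pos
  have hα := hw.alpha_pos
  have hu := hw.contDiff_u.differentiable two_ne_zero z |>.hasDerivAt
  have hv := hw.contDiff_v.differentiable two_ne_zero z |>.hasDerivAt
  have hu' := ((contDiff_succ_iff_deriv (n := 1)).1 hw.contDiff_u).2.2.differentiable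
    one_ne_zero z |>.hasDerivAt
  have hv' := ((contDiff_succ_iff_deriv (n := 1)).1 hw.contDiff_v).2.2.differentiable
    one_ne_zero z |>.hasDerivAt
  have hf := (hw.contDiff_f.differentiable two_ne_zero (uh z)).hasDerivAt.comp z hu
  have hg := (hw.contDiff_g.differentiable two_ne_zero (vh z)).hasDerivAt.comp z hv
  have eu : deriv (deriv uh) = fun z => -c * deriv uh z - f (uh z) + σ * vh z := by
    funext s; linarith [hw.wave_u s]
  have ev : deriv (deriv vh) = fun z => -c * deriv vh z - g (vh z) - α * uh z := by
    funext s; linarith [hw.wave_v s]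
  have hu'' : HasDerivAt (deriv (deriv uh))
      (-c * deriv (deriv uh) z - deriv f (uh z) * deriv uh z + σ * deriv vh z) z := by
    conv => arg 1; rw [eu]
    exact ((hu'.const_mul (-c)).sub hf).add (hv.const_mul σ)
  have hv'' : HasDerivAt (deriv (deriv vh))
      (-c * deriv (deriv vh) z - deriv g (vh z) * deriv vh z - α * deriv uh z) z := by
    conv => arg 1; rw [ev]
    exact ((hv'.const_mul (-c)).sub hg).sub (hu.const_mul α)
  rw [hasDerivAt_pi]
  intro i
  fin_cases i <;> simp [profileDeriv, realMatrix, coeffMatrix, Matrix.mulVec, dotProduct,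
    Fin.sum_univ_succ]
  · refine hu'.congr_deriv ?_
    field_simp
  · refine hv'.congr_deriv ?_
    field_simp
  · refine (hu''.div_const σ).congr_deriv ?_
    field_simp
    ring
  · refine (hv''.div_const α).congr_deriv ?_
    field_simp
    ring

end Wave

/-! ### Solutions of the linearized equations -/

section Solutions

variable {f g : ℝ → ℝ} {σ α c ν₁ ν₂ : ℝ} {uh vh : ℝ → ℝ}

/-- A real curve regarded as a complex one. -/
def complexify (u : ℝ → Fin 4 → ℝ) (z : ℝ) : Fin 4 → ℂ := fun i => (u z i : ℂ)

theorem norm_complexify (u : ℝ → Fin 4 → ℝ) (z : ℝ) : ‖complexify u z‖ = ‖u z‖ := by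
  simp [complexify, Pi.norm_def, nnnorm]

/-- The derivative of `A(λ, z)` with respect to `λ`. -/
def paramMatrix (σ α : ℝ) : Matrix (Fin 4) (Fin 4) ℂ :=
  Matrix.single 2 0 (σ : ℂ)⁻¹ + Matrix.single 3 1 (α : ℂ)⁻¹

/-- `A(λ, z) - A∞(λ)`. -/
def perturbation (f g : ℝ → ℝ) (σ α : ℝ) (uh vh : ℝ → ℝ) (z : ℝ) : Matrix (Fin 4) (Fin 4) ℂ :=
  (((deriv f 0 - deriv f (uh z)) / σ : ℝ) : ℂ) • Matrix.single 2 0 1 +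
    (((deriv g 0 - deriv g (vh z)) / α : ℝ) : ℂ) • Matrix.single 3 1 1

theorem matrixA_eq_add_perturbation (f g : ℝ → ℝ) (σ α c : ℝ) (uh vh : ℝ → ℝ) (lam : ℂ) (z : ℝ) :
    matrixA f g σ α c uh vh lam z =
      matrixAInfty f g σ α c lam + perturbation f g σ α uh vh z := by
  ext i j
  fin_cases i <;> fin_cases j <;>
    simp [matrixA, matrixAInfty, perturbation, coeffMatrix, Matrix.single] <;> ring

theorem matrixA_eq_add_smul (f g : ℝ → ℝ) (σ α c : ℝ) (uh vh : ℝ → ℝ) (lam : ℂ) (z : ℝ) :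
    matrixA f g σ α c uh vh lam z = matrixA f g σ α c uh vh 0 z + lam • paramMatrix σ α := by
  ext i j
  fin_cases i <;> fin_cases j <;>
    simp [matrixA, paramMatrix, coeffMatrix, Matrix.single] <;> ring

theorem matrixAInfty_eq_add_smul (f g : ℝ → ℝ) (σ α c : ℝ) (lam : ℂ) :
    matrixAInfty f g σ α c lam = matrixAInfty f g σ α c 0 + lam • paramMatrix σ α := by
  ext i j
  fin_cases i <;> fin_cases j <;>
    simp [matrixAInfty, paramMatrix, coeffMatrix, Matrix.single] <;> ring

theorem trace_matrixA (f g : ℝ → ℝ) (σ α c : ℝ) (uh vh : ℝ → ℝ) (lam : ℂ) (z : ℝ) :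
    (matrixA f g σ α c uh vh lam z).trace = -2 * c := trace_coeffMatrix

theorem hasDerivAt_complexify {u : ℝ → Fin 4 → ℝ} {z : ℝ}
    (hu : HasDerivAt u ((realMatrix f g σ α c uh vh z).mulVec (u z)) z) :
    HasDerivAt (complexify u) ((matrixA f g σ α c uh vh 0 z).mulVec (complexify u z)) z := by
  rw [hasDerivAt_pi] at hu ⊢
  intro i
  refine (hu i).ofReal_comp.congr_deriv ?_
  fin_cases i <;> simp [matrixA, realMatrix, coeffMatrix, Matrix.mulVec, dotProduct,
    Fin.sum_univ_succ, complexify]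

theorem IsTravelingWave.exists_perturbation_bound (hw : IsTravelingWave f g σ α c ν₁ ν₂ uh vh)
    {F : Type*} [NormedAddCommGroup F] [NormedSpace ℂ F] (T : Matrix (Fin 4) (Fin 4) ℂ → F)
    (hT : IsLinearMap ℂ T) :
    ∃ r, 0 ≤ r ∧ ∀ z, ∀ μ ∈ ({rateMinus c ν₂, ratePlus c ν₂} : Set ℝ),
      ‖T (perturbation f g σ α uh vh z)‖ ≤ r * Real.exp (μ * z) := by
  have hσ := hw.sigma_pos
  have hα := hw.alpha_pos
  obtain ⟨C, hC0, hC⟩ := hw.exists_decay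
  refine ⟨C / σ * ‖T (Matrix.single 2 0 1)‖ + C / α * ‖T (Matrix.single 3 1 1)‖, by positivity,
    fun z μ hμ => ?_⟩
  obtain ⟨h1, h2, -⟩ := hC z μ hμ
  rw [perturbation, hT.map_add, hT.map_smul, hT.map_smul]
  refine (norm_add_le _ _).trans ?_
  rw [norm_smul, norm_smul, Complex.norm_real, Complex.norm_real, Real.norm_eq_abs,
    Real.norm_eq_abs, abs_div, abs_div, abs_of_pos hσ, abs_of_pos hα, abs_sub_comm,
    abs_sub_comm (deriv g 0)]
  calc _ ≤ C * Real.exp (μ * z) / σ * ‖T (Matrix.single 2 0 1)‖ +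
        C * Real.exp (μ * z) / α * ‖T (Matrix.single 3 1 1)‖ := by gcongr
    _ = _ := by ring

theorem isLinearMap_inducedCLM : IsLinearMap ℂ inducedCLM := ⟨inducedCLM_add, inducedCLM_smul⟩

theorem isLinearMap_mulVecCLM {n : ℕ} : IsLinearMap ℂ (mulVecCLM (n := n)) :=
  ⟨fun A B => by ext1 y; exact Matrix.add_mulVec A B y,
    fun t A => by ext1 y; exact Matrix.smul_mulVec t A y⟩

theorem differentiableAt_inducedCLM_matrixAInfty (f g : ℝ → ℝ) (σ α c : ℝ) :
    DifferentiableAt ℂ (fun lam => inducedCLM (matrixAInfty f g σ α c lam)) 0 := by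
  have : (fun lam => inducedCLM (matrixAInfty f g σ α c lam)) = fun lam =>
      inducedCLM (matrixAInfty f g σ α c 0) + lam • inducedCLM (paramMatrix σ α) := by
    funext lam
    rw [matrixAInfty_eq_add_smul, inducedCLM_add, inducedCLM_smul]
  rw [this]
  exact (differentiableAt_id.smul_const _).const_add _

theorem hasDerivAt_induced_iff {Z : ℝ → Fin 6 → ℂ} {lam : ℂ} {z : ℝ} :
    HasDerivAt Z (induced (matrixA f g σ α c uh vh lam z) (Z z)) z ↔
    HasDerivAt Z (inducedCLM (matrixAInfty f g σ α c lam) (Z z) +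
      inducedCLM (perturbation f g σ α uh vh z) (Z z)) z := by
  rw [matrixA_eq_add_perturbation, add_induced]
  rfl

/-- Reversing z negates the operator, so the largest rate at -∞ becomes the smallest at +∞ and the
forward estimates apply. -/
theorem HasDerivAt.reflect {E : Type*} [NormedAddCommGroup E] [NormedSpace ℂ E]
    {B : E →L[ℂ] E} {R : ℝ → E →L[ℂ] E} {Z : ℝ → E}
    (h : ∀ z, HasDerivAt Z (B (Z z) + R z (Z z)) z) (z : ℝ) :
    HasDerivAt (fun z => Z (-z)) ((-B) (Z (-z)) + (-R (-z)) (Z (-z))) z := by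
  refine ((h (-z)).scomp z (hasDerivAt_neg z)).congr_deriv ?_
  simp

theorem IsEvansDomain.mem_nhds {U : Set ℂ} (hU : IsEvansDomain f g σ α c U) : U ∈ 𝓝 (0 : ℂ) :=
  hU.isOpen.mem_nhds (hU.halfPlane 0 le_rfl)

theorem IsStableTwoVector.exists_lipschitz (hw : IsTravelingWave f g σ α c ν₁ ν₂ uh vh)
    {U : Set ℂ} (hU : IsEvansDomain f g σ α c U) {ζ : ℂ → Fin 6 → ℂ} {Es : ℂ → ℝ → Fin 6 → ℂ}
    (hEs : IsStableTwoVector f g σ α c ν₁ ν₂ uh vh U ζ Es) :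
    ∃ C, ∀ᶠ lam in 𝓝 (0 : ℂ), ∀ z : ℝ, 0 ≤ z →
      ‖Complex.exp (-(muMinus c ν₁ lam + muMinus c ν₂ lam) * z) • Es lam z‖ ≤ C ∧
      ‖Complex.exp (-(muMinus c ν₁ lam + muMinus c ν₂ lam) * z) • Es lam z -
        Complex.exp (-(muMinus c ν₁ 0 + muMinus c ν₂ 0) * z) • Es 0 z‖ ≤ C * ‖lam‖ := by
  obtain ⟨r, hr, hR⟩ := hw.exists_perturbation_bound inducedCLM isLinearMap_inducedCLM
  obtain ⟨a, b, hF⟩ := hw.exists_frame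
  have h2 := hw.eigenvalue_neg
  have hm := rateMinus_neg (c := c) h2
  exact exists_weighted_lipschitz (m := fun lam => muMinus c ν₁ lam + muMinus c ν₂ lam)
    (B := fun lam => inducedCLM (matrixAInfty f g σ α c lam))
    (R := fun z => inducedCLM (perturbation f g σ α uh vh z)) hr (neg_pos.2 hm)
    (fun z => by simpa using hR z _ (Or.inl rfl))
    (hF.mono fun lam ⟨ℓ, w, θ, h1, h2, _⟩ => ⟨ℓ, w, θ, h1, h2⟩)
    (differentiableAt_inducedCLM_matrixAInfty f g σ α c)
    ((differentiableAt_muMinus (hw.eigenvalue_lt.trans h2)).add (differentiableAt_muMinus h2))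
    (hEs.analytic 0 (hU.halfPlane 0 le_rfl)).differentiableAt
    (mem_of_superset hU.mem_nhds fun lam h => hEs.eigenvector lam h)
    (mem_of_superset hU.mem_nhds fun lam h z => hasDerivAt_induced_iff.1 (hEs.solution lam h z))
    (mem_of_superset hU.mem_nhds fun lam h => hEs.limit lam h)

theorem IsUnstableTwoVector.exists_lipschitz (hw : IsTravelingWave f g σ α c ν₁ ν₂ uh vh)
    {U : Set ℂ} (hU : IsEvansDomain f g σ α c U) {ζ : ℂ → Fin 6 → ℂ} {Eu : ℂ → ℝ → Fin 6 → ℂ}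
    (hEu : IsUnstableTwoVector f g σ α c ν₁ ν₂ uh vh U ζ Eu) :
    ∃ C, ∀ᶠ lam in 𝓝 (0 : ℂ), ∀ z : ℝ, z ≤ 0 →
      ‖Complex.exp (-(muPlus c ν₂ lam + muPlus c ν₁ lam) * z) • Eu lam z‖ ≤ C ∧
      ‖Complex.exp (-(muPlus c ν₂ lam + muPlus c ν₁ lam) * z) • Eu lam z -
        Complex.exp (-(muPlus c ν₂ 0 + muPlus c ν₁ 0) * z) • Eu 0 z‖ ≤ C * ‖lam‖ := by
  obtain ⟨r, hr, hR⟩ := hw.exists_perturbation_bound inducedCLM isLinearMap_inducedCLM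
  obtain ⟨a, b, hF⟩ := hw.exists_frame
  have h2 := hw.eigenvalue_neg
  have hp := ratePlus_pos (c := c) h2
  obtain ⟨C, hC⟩ := exists_weighted_lipschitz
    (m := fun lam => -(muPlus c ν₂ lam + muPlus c ν₁ lam))
    (B := fun lam => -inducedCLM (matrixAInfty f g σ α c lam)) (ζ := ζ)
    (R := fun z => -inducedCLM (perturbation f g σ α uh vh (-z)))
    (Z := fun lam z => Eu lam (-z)) hr hp
    (fun z => by simpa using hR (-z) _ (Or.inr rfl))
    (hF.mono fun lam ⟨ℓ, w, θ, h1, _, h2⟩ => ⟨ℓ, w, -θ, h1.neg, fun k => by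
      simpa using h2 k⟩)
    (differentiableAt_inducedCLM_matrixAInfty f g σ α c).neg
    ((differentiableAt_muPlus h2).add (differentiableAt_muPlus (hw.eigenvalue_lt.trans h2))).neg
    (hEu.analytic 0 (hU.halfPlane 0 le_rfl)).differentiableAt
    (mem_of_superset hU.mem_nhds fun lam h => by
      simp only [Set.mem_ofPred_eq, neg_apply, inducedCLM_apply, hEu.eigenvector lam h, neg_smul])
    (mem_of_superset hU.mem_nhds fun lam h z => HasDerivAt.reflect
      (R := fun z => inducedCLM (perturbation f g σ α uh vh z))
      (fun z => hasDerivAt_induced_iff.1 (hEu.solution lam h z)) z)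
    (mem_of_superset hU.mem_nhds fun lam h => by
      refine ((hEu.limit lam h).comp tendsto_neg_atTop_atBot).congr fun z => ?_
      simp [-neg_add_rev])
  refine ⟨C, hC.mono fun lam h z hz => ?_⟩
  simpa [-neg_add_rev] using h (-z) (by linarith)

theorem hasDerivAt_wedgeTwo_complexify {u v : ℝ → Fin 4 → ℝ}
    (hu : ∀ z, HasDerivAt u ((realMatrix f g σ α c uh vh z).mulVec (u z)) z)
    (hv : ∀ z, HasDerivAt v ((realMatrix f g σ α c uh vh z).mulVec (v z)) z) (z : ℝ) :
    HasDerivAt (fun z => wedgeTwo (complexify u z) (complexify v z))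
      (induced (matrixA f g σ α c uh vh 0 z) (wedgeTwo (complexify u z) (complexify v z))) z := by
  rw [induced_wedgeTwo]
  exact (hasDerivAt_complexify (hu z)).wedgeTwo (hasDerivAt_complexify (hv z))

theorem ofReal_mul_wedgeTwo (m z : ℝ) (u v : ℝ → Fin 4 → ℝ) :
    (fun k : Fin 6 => ((Real.exp (-m * z) * wedgeTwo (u z) (v z) k : ℝ) : ℂ)) =
      Complex.exp (-(m : ℂ) * z) • wedgeTwo (complexify u z) (complexify v z) := by
  funext k
  simp [wedgeTwo, complexify]

/-- The wedge of two solutions solves the induced equation, and since μ₁ + μ₂ is the smallest rate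
the leading coefficient at +∞ determines the solution. -/
theorem IsStableTwoVector.at_zero_eq (hw : IsTravelingWave f g σ α c ν₁ ν₂ uh vh)
    {U : Set ℂ} (hU : IsEvansDomain f g σ α c U) {ζ : ℂ → Fin 6 → ℂ} {Es : ℂ → ℝ → Fin 6 → ℂ}
    (hEs : IsStableTwoVector f g σ α c ν₁ ν₂ uh vh U ζ Es) {u v : ℝ → Fin 4 → ℝ}
    (hu : ∀ z, HasDerivAt u ((realMatrix f g σ α c uh vh z).mulVec (u z)) z)
    (hv : ∀ z, HasDerivAt v ((realMatrix f g σ α c uh vh z).mulVec (v z)) z)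
    (hl : Tendsto (fun z : ℝ => fun k : Fin 6 => ((Real.exp (-(rateMinus c ν₁ + rateMinus c ν₂) * z) *
        wedgeTwo (u z) (v z) k : ℝ) : ℂ)) atTop (𝓝 (ζ 0))) (z : ℝ) :
    Es 0 z = wedgeTwo (complexify u z) (complexify v z) := by
  obtain ⟨r, hr, hR⟩ := hw.exists_perturbation_bound inducedCLM isLinearMap_inducedCLM
  obtain ⟨a, b, hF⟩ := hw.exists_frame
  obtain ⟨ℓ, w, θ, h1, h3, -⟩ := hF.self_of_nhds
  have h2 := hw.eigenvalue_neg
  have hm := rateMinus_neg (c := c) h2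
  have h0 := hU.halfPlane 0 le_rfl
  refine eq_of_same_limit h1 h3 hr (neg_pos.2 hm)
    (R := fun z => inducedCLM (perturbation f g σ α uh vh z))
    (fun z => by simpa using hR z _ (Or.inl rfl))
    (fun z => hasDerivAt_induced_iff.1 (hEs.solution 0 h0 z))
    (fun z => hasDerivAt_induced_iff.1 (hasDerivAt_wedgeTwo_complexify hu hv z))
    (hEs.limit 0 h0) (hl.congr fun z => ?_) z
  rw [ofReal_mul_wedgeTwo, muMinus_zero c ν₁ (hw.eigenvalue_lt.trans h2).le,
    muMinus_zero c ν₂ h2.le, Complex.ofReal_add]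

theorem IsUnstableTwoVector.at_zero_eq (hw : IsTravelingWave f g σ α c ν₁ ν₂ uh vh)
    {U : Set ℂ} (hU : IsEvansDomain f g σ α c U) {ζ : ℂ → Fin 6 → ℂ} {Eu : ℂ → ℝ → Fin 6 → ℂ}
    (hEu : IsUnstableTwoVector f g σ α c ν₁ ν₂ uh vh U ζ Eu) {u v : ℝ → Fin 4 → ℝ}
    (hu : ∀ z, HasDerivAt u ((realMatrix f g σ α c uh vh z).mulVec (u z)) z)
    (hv : ∀ z, HasDerivAt v ((realMatrix f g σ α c uh vh z).mulVec (v z)) z)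
    (hl : Tendsto (fun z : ℝ => fun k : Fin 6 => ((Real.exp (-(ratePlus c ν₂ + ratePlus c ν₁) * z) *
        wedgeTwo (u z) (v z) k : ℝ) : ℂ)) atBot (𝓝 (ζ 0))) (z : ℝ) :
    Eu 0 z = wedgeTwo (complexify u z) (complexify v z) := by
  obtain ⟨r, hr, hR⟩ := hw.exists_perturbation_bound inducedCLM isLinearMap_inducedCLM
  obtain ⟨a, b, hF⟩ := hw.exists_frame
  obtain ⟨ℓ, w, θ, h1, -, h3⟩ := hF.self_of_nhds
  have h2 := hw.eigenvalue_neg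
  have hp := ratePlus_pos (c := c) h2
  have h0 := hU.halfPlane 0 le_rfl
  have := eq_of_same_limit (m := -(muPlus c ν₂ 0 + muPlus c ν₁ 0)) (ζ := ζ 0) h1.neg
    (fun k => by simpa using h3 k) hr hp
    (R := fun z => -inducedCLM (perturbation f g σ α uh vh (-z)))
    (Z₁ := fun z => Eu 0 (-z)) (Z₂ := fun z => wedgeTwo (complexify u (-z)) (complexify v (-z)))
    (fun z => by simpa using hR (-z) _ (Or.inr rfl))
    (HasDerivAt.reflect (R := fun z => inducedCLM (perturbation f g σ α uh vh z))
      fun z => hasDerivAt_induced_iff.1 (hEu.solution 0 h0 z))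
    (HasDerivAt.reflect (R := fun z => inducedCLM (perturbation f g σ α uh vh z))
      (Z := fun z => wedgeTwo (complexify u z) (complexify v z))
      fun z => hasDerivAt_induced_iff.1 (hasDerivAt_wedgeTwo_complexify hu hv z))
    (((hEu.limit 0 h0).comp tendsto_neg_atTop_atBot).congr fun z => by simp [-neg_add_rev])
    ((hl.comp tendsto_neg_atTop_atBot).congr fun z => ?_) (-z)
  · simpa using this
  · simp only [Function.comp]
    rw [ofReal_mul_wedgeTwo, muPlus_zero c ν₁ (hw.eigenvalue_lt.trans h2).le,
      muPlus_zero c ν₂ h2.le, Complex.ofReal_add]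
    simp [-neg_add_rev]

/-- Solutions at `λ = 0` grow at most like the largest exponential forwards and the smallest one
backwards. -/
theorem IsTravelingWave.exists_growth (hw : IsTravelingWave f g σ α c ν₁ ν₂ uh vh)
    {u : ℝ → Fin 4 → ℝ}
    (hu : ∀ z, HasDerivAt u ((realMatrix f g σ α c uh vh z).mulVec (u z)) z) :
    ∃ C, (∀ z, 0 ≤ z → ‖u z‖ ≤ C * Real.exp (ratePlus c ν₁ * z)) ∧
      ∀ z, z ≤ 0 → ‖u z‖ ≤ C * Real.exp (rateMinus c ν₁ * z) := by
  obtain ⟨r, hr, hR⟩ := hw.exists_perturbation_bound mulVecCLM isLinearMap_mulVecCLM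
  obtain ⟨ℓ, a, b, hF⟩ := exists_isDiagonalFrame_mulVecCLM (hw.mulVec_eigenbasis 0)
    hw.det_eigenbasis_ne_zero
  have h2 := hw.eigenvalue_neg
  have h1 := hw.eigenvalue_lt.trans h2
  have hm := rateMinus_neg (c := c) h2
  have hp := ratePlus_pos (c := c) h2
  have o1 := rateMinus_lt_rateMinus (c := c) hw.eigenvalue_lt h2
  have o2 := ratePlus_lt_ratePlus (c := c) hw.eigenvalue_lt h2
  have hu' : ∀ z, HasDerivAt (complexify u) (mulVecCLM (matrixAInfty f g σ α c 0) (complexify u z) +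
      mulVecCLM (perturbation f g σ α uh vh z) (complexify u z)) z := fun z => by
    refine (hasDerivAt_complexify (hu z)).congr_deriv ?_
    rw [matrixA_eq_add_perturbation, Matrix.add_mulVec]
    rfl
  -- Removing the largest rate μ₄ leaves eigenvalues with nonpositive real part; backwards the same
  -- works with -A∞ and the rate -μ₁.
  obtain ⟨C₁, hC₁⟩ := exists_norm_le_of_re_nonpos (hF.sub_smul (ratePlus c ν₁ : ℂ))
    (fun k => by
      fin_cases k <;> simp [mus, muMinus_zero c ν₁ h1.le, muMinus_zero c ν₂ h2.le,
        muPlus_zero c ν₁ h1.le, muPlus_zero c ν₂ h2.le] <;> linarith)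
    hr (neg_pos.2 hm) (R := fun z => mulVecCLM (perturbation f g σ α uh vh z))
    (fun z => by simpa using hR z _ (Or.inl rfl))
    (fun z => hasDerivAt_exp_smul (ratePlus c ν₁ : ℂ) (hu' z))
  obtain ⟨C₂, hC₂⟩ := exists_norm_le_of_re_nonpos (hF.neg.sub_smul (-rateMinus c ν₁ : ℂ))
    (fun k => by
      fin_cases k <;> simp [mus, muMinus_zero c ν₁ h1.le, muMinus_zero c ν₂ h2.le,
        muPlus_zero c ν₁ h1.le, muPlus_zero c ν₂ h2.le] <;> linarith)
    hr hp (R := fun z => -mulVecCLM (perturbation f g σ α uh vh (-z)))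
    (fun z => by simpa using hR (-z) _ (Or.inr rfl))
    (fun z => hasDerivAt_exp_smul (-rateMinus c ν₁ : ℂ) (HasDerivAt.reflect
      (R := fun z => mulVecCLM (perturbation f g σ α uh vh z)) hu' z))
  refine ⟨max C₁ C₂, fun z hz => ?_, fun z hz => ?_⟩
  · have h := hC₁ z hz
    rw [norm_smul, Complex.norm_exp, norm_complexify] at h
    refine (norm_le_mul_exp (μ := ratePlus c ν₁) (z := z) (C := C₁) ?_).trans ?_
    · rw [norm_smul, Real.norm_eq_abs, Real.abs_exp]
      simpa using h
    · gcongr; exact le_max_left _ _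
  · have h := hC₂ (-z) (by linarith)
    rw [norm_smul, Complex.norm_exp, norm_complexify, neg_neg] at h
    refine (norm_le_mul_exp (μ := rateMinus c ν₁) (z := z) (C := C₂) ?_).trans ?_
    · rw [norm_smul, Real.norm_eq_abs, Real.abs_exp]
      simpa using h
    · gcongr; exact le_max_right _ _

end Solutions

/-! ### Half-line integrals and limits -/

section HalfLine

/-- If `F' = λ q` with `F`, `q` exponentially small at `∞` uniformly in `λ`, then
`F(0) / λ` tends to minus the integral of `q` at `λ = 0`. -/
theorem tendsto_inv_mul_of_hasDerivAt {F q : ℂ → ℝ → ℂ} {K K' ε : ℝ} (hε : 0 < ε)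
    (hF : ∀ᶠ lam in 𝓝 (0 : ℂ), ∀ z, HasDerivAt (F lam) (lam * q lam z) z)
    (hq : ∀ᶠ lam in 𝓝 (0 : ℂ), Continuous (q lam))
    (hFb : ∀ᶠ lam in 𝓝 (0 : ℂ), ∀ z, 0 ≤ z → ‖F lam z‖ ≤ K' * Real.exp (-ε * z))
    (hqb : ∀ᶠ lam in 𝓝 (0 : ℂ), ∀ z, 0 ≤ z → ‖q lam z‖ ≤ K * Real.exp (-ε * z))
    (hlim : ∀ z, 0 ≤ z → Tendsto (fun lam => q lam z) (𝓝 0) (𝓝 (q 0 z))) :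
    IntegrableOn (q 0) (Set.Ioi 0) ∧
    Tendsto (fun lam => lam⁻¹ * F lam 0) (𝓝[≠] 0) (𝓝 (-∫ z in Set.Ioi 0, q 0 z)) := by
  have hK : IntegrableOn (fun z => K * Real.exp (-ε * z)) (Set.Ioi 0) :=
    (integrableOn_exp_mul_Ioi (by linarith) 0).const_mul K
  have hb : ∀ᶠ lam in 𝓝 (0 : ℂ), ∀ᵐ z ∂volume.restrict (Set.Ioi (0 : ℝ)),
      ‖q lam z‖ ≤ K * Real.exp (-ε * z) := hqb.mono fun lam h =>
    (ae_restrict_mem measurableSet_Ioi).mono fun z hz => h z (le_of_lt hz)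
  have hint : ∀ᶠ lam in 𝓝 (0 : ℂ), IntegrableOn (q lam) (Set.Ioi 0) := by
    filter_upwards [hq, hb] with lam h1 h2
    exact Integrable.mono' hK h1.aestronglyMeasurable h2
  refine ⟨hint.self_of_nhds, ?_⟩
  have h1 := tendsto_integral_filter_of_dominated_convergence _
    (hq.mono fun lam h => h.aestronglyMeasurable) hb hK
    ((ae_restrict_mem measurableSet_Ioi).mono fun z hz => hlim z (le_of_lt hz))
  refine ((h1.mono_left nhdsWithin_le_nhds).neg).congr' ?_
  filter_upwards [self_mem_nhdsWithin, nhdsWithin_le_nhds hF, nhdsWithin_le_nhds hFb,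
    nhdsWithin_le_nhds hint] with lam h0 h1 h2 h3
  have h4 : Tendsto (F lam) atTop (𝓝 0) := by
    refine squeeze_zero_norm' (eventually_ge_atTop 0 |>.mono fun z hz => h2 z hz) ?_
    simpa using (tendsto_exp_neg_mul hε).const_mul K'
  have h5 := integral_Ioi_of_hasDerivAt_of_tendsto' (fun z _ => h1 z) (h3.const_mul lam) h4
  rw [integral_const_mul, zero_sub] at h5
  have h0' : lam ≠ 0 := h0
  rw [show F lam 0 = -(lam * ∫ z in Set.Ioi 0, q lam z) by rw [h5, neg_neg], mul_neg,
    inv_mul_cancel_left₀ h0']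

theorem eq_zero_of_norm_le_exp {x K ε : ℝ} (hε : 0 < ε)
    (h : ∀ z, 0 ≤ z → |x| ≤ K * Real.exp (-ε * z)) : x = 0 := by
  have h1 : Tendsto (fun z => K * Real.exp (-ε * z)) atTop (𝓝 0) := by
    simpa using (tendsto_exp_neg_mul hε).const_mul K
  exact abs_nonpos_iff.1 (ge_of_tendsto h1 (eventually_ge_atTop 0 |>.mono h))

theorem norm_exp_mul_wedgeFour_le (T : (Fin 6 → ℂ) →L[ℂ] (Fin 6 → ℂ)) {Z W : Fin 6 → ℂ}
    {c z C₁ C₂ a b d : ℝ} (hZ : ‖Z‖ ≤ C₁ * Real.exp (a * z)) (hW : ‖W‖ ≤ C₂ * Real.exp (b * z))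
    (hd : 2 * c + a + b = d) :
    ‖Complex.exp (2 * (c : ℂ) * z) * wedgeFour (T Z) W‖ ≤
      6 * (‖T‖ * C₁ * C₂) * Real.exp (d * z) := by
  have h0 : ‖Complex.exp (2 * (c : ℂ) * z)‖ = Real.exp (2 * c * z) := by
    rw [show (2 * (c : ℂ) * z) = ((2 * c * z : ℝ) : ℂ) by push_cast; ring, Complex.norm_exp,
      Complex.ofReal_re]
  have h1 : ‖T Z‖ ≤ ‖T‖ * (C₁ * Real.exp (a * z)) := (T.le_opNorm Z).trans (by gcongr)
  rw [norm_mul, h0]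
  calc _ ≤ Real.exp (2 * c * z) * (6 * (‖T Z‖ * ‖W‖)) := by
        gcongr; exact norm_wedgeFour_le _ _
    _ ≤ Real.exp (2 * c * z) * (6 * ((‖T‖ * (C₁ * Real.exp (a * z))) *
        (C₂ * Real.exp (b * z)))) := by
        have := (norm_nonneg _).trans h1
        gcongr
    _ = 6 * (‖T‖ * C₁ * C₂) * (Real.exp (2 * c * z) * Real.exp (a * z) * Real.exp (b * z)) := by
        ring
    _ = _ := by
        rw [← Real.exp_add, ← Real.exp_add, ← hd]
        ring_nf

/-- For fixed z the weight is continuous and nonvanishing in λ, so it can be divided out. -/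
theorem tendsto_of_weighted_lipschitz {E : Type*} [NormedAddCommGroup E] [NormedSpace ℂ E]
    {m : ℂ → ℂ} {Z : ℂ → E} {C z : ℝ} (hm : ContinuousAt m 0)
    (h : ∀ᶠ lam in 𝓝 (0 : ℂ), ‖Complex.exp (-m lam * z) • Z lam -
      Complex.exp (-m 0 * z) • Z 0‖ ≤ C * ‖lam‖) :
    Tendsto Z (𝓝 0) (𝓝 (Z 0)) := by
  have h1 : Tendsto (fun lam => Complex.exp (-m lam * z) • Z lam) (𝓝 0)
      (𝓝 (Complex.exp (-m 0 * z) • Z 0)) := by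
    rw [tendsto_iff_norm_sub_tendsto_zero]
    refine squeeze_zero' (Eventually.of_forall fun _ => norm_nonneg _) h ?_
    simpa using (tendsto_norm_zero (E := ℂ)).const_mul C
  have h2 : ContinuousAt (fun lam => Complex.exp (m lam * z)) 0 := by fun_prop
  have h3 := h2.tendsto.smul h1
  simp only [smul_smul, ← Complex.exp_add, neg_mul, add_neg_cancel, Complex.exp_zero,
    one_smul] at h3
  exact h3

end HalfLine

/-! ### Wronskian identities and bounds for the Evans function -/

section Evans

variable {f g : ℝ → ℝ} {σ α c ν₁ ν₂ : ℝ} {uh vh : ℝ → ℝ}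

/-- The Wronskian-type identity for two-vectors at different values of the spectral parameter. -/
theorem hasDerivAt_exp_mul_wedgeFour {Z W : ℝ → Fin 6 → ℂ} {lam lam' : ℂ} {z : ℝ}
    (hZ : HasDerivAt Z (induced (matrixA f g σ α c uh vh lam z) (Z z)) z)
    (hW : HasDerivAt W (induced (matrixA f g σ α c uh vh lam' z) (W z)) z) :
    HasDerivAt (fun z : ℝ => Complex.exp (2 * (c : ℂ) * z) * wedgeFour (Z z) (W z))
      ((lam - lam') * (Complex.exp (2 * (c : ℂ) * z) *
        wedgeFour (inducedCLM (paramMatrix σ α) (Z z)) (W z))) z := by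
  have h1 : HasDerivAt (fun z : ℝ => Complex.exp (2 * (c : ℂ) * z))
      (Complex.exp (2 * (c : ℂ) * z) * (2 * c)) z := by
    have : HasDerivAt (fun z : ℂ => Complex.exp (2 * (c : ℂ) * z))
        (Complex.exp (2 * (c : ℂ) * z) * (2 * c)) (z : ℂ) := by
      simpa using ((hasDerivAt_id (z : ℂ)).const_mul (2 * (c : ℂ))).cexp
    exact this.comp_ofReal
  refine (h1.mul (hZ.wedgeFour hW)).congr_deriv ?_
  have h2 := wedgeFour_induced (matrixA f g σ α c uh vh 0 z) (Z z) (W z)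
  -- B has trace 0, so the λ'-term on W moves onto Z with the opposite sign; the trace -2c of A(0,
  -- z) cancels the derivative of the weight.
  have h3 := wedgeFour_induced (paramMatrix σ α) (Z z) (W z)
  have h4 : (paramMatrix σ α).trace = 0 := by
    simp [paramMatrix, Matrix.trace, Fin.sum_univ_succ, Matrix.single]
  rw [h4, zero_mul] at h3
  rw [trace_matrixA] at h2
  rw [matrixA_eq_add_smul f g σ α c uh vh lam, matrixA_eq_add_smul f g σ α c uh vh lam',
    add_induced, add_induced, smul_induced, smul_induced, wedgeFour_add_left, wedgeFour_add_right,
    wedgeFour_smul_left, wedgeFour_smul_right, inducedCLM_apply]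
  linear_combination Complex.exp (2 * (c : ℂ) * z) * (h2 + lam' * h3)

theorem eq_of_hasDerivAt_zero {F : Type*} [NormedAddCommGroup F] [NormedSpace ℝ F] {h : ℝ → F}
    (hh : ∀ z, HasDerivAt h 0 z) (z z' : ℝ) : h z = h z' :=
  is_const_of_deriv_eq_zero (fun z => (hh z).differentiableAt) (fun z => (hh z).deriv) z z'

/-- At λ = 0 one has ω(Aa, b) + ω(a, Ab) = -c ω(a, b): the couplings +1 and -1 cancel thanks to the
minus sign in ω, and only the friction -c survives. -/
theorem weightedOmega_eq {u v : ℝ → Fin 4 → ℝ} (hσ : σ ≠ 0) (hα : α ≠ 0)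
    (hu : ∀ z, HasDerivAt u ((realMatrix f g σ α c uh vh z).mulVec (u z)) z)
    (hv : ∀ z, HasDerivAt v ((realMatrix f g σ α c uh vh z).mulVec (v z)) z) (z z' : ℝ) :
    weightedOmega c z (u z) (v z) = weightedOmega c z' (u z') (v z') := by
  refine eq_of_hasDerivAt_zero (h := fun z => weightedOmega c z (u z) (v z)) (fun z => ?_) z z'
  have h1 : HasDerivAt (fun z : ℝ => Real.exp (c * z)) (Real.exp (c * z) * c) z := by
    simpa using ((hasDerivAt_id z).const_mul c).exp
  have hu := hasDerivAt_pi.1 (hu z)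
  have hv := hasDerivAt_pi.1 (hv z)
  refine (h1.mul ((((hu 0).mul (hv 2)).sub ((hu 2).mul (hv 0))).sub
    (((hu 1).mul (hv 3)).sub ((hu 3).mul (hv 1))))).congr_deriv ?_
  simp [realMatrix, coeffMatrix, Matrix.mulVec, dotProduct, Fin.sum_univ_succ]
  field_simp
  ring

theorem abs_omegaForm_le (a b : Fin 4 → ℝ) : |omegaForm a b| ≤ 4 * (‖a‖ * ‖b‖) := by
  have h : ∀ i j, |a i * b j| ≤ ‖a‖ * ‖b‖ := fun i j => by
    rw [abs_mul]
    gcongr <;> exact norm_le_pi_norm (_ : Fin 4 → ℝ) _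
  unfold omegaForm
  have e1 := abs_sub (a 0 * b 2 - a 2 * b 0) (a 1 * b 3 - a 3 * b 1)
  have e2 := abs_sub (a 0 * b 2) (a 2 * b 0)
  have e3 := abs_sub (a 1 * b 3) (a 3 * b 1)
  linarith [h 0 2, h 2 0, h 1 3, h 3 1]

theorem abs_weightedOmega_le {u v : Fin 4 → ℝ} {z C₁ C₂ a b d : ℝ}
    (hu : ‖u‖ ≤ C₁ * Real.exp (a * z)) (hv : ‖v‖ ≤ C₂ * Real.exp (b * z)) (hd : c + a + b = d) :
    |weightedOmega c z u v| ≤ 4 * (C₁ * C₂) * Real.exp (d * z) := by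
  rw [weightedOmega, abs_mul, Real.abs_exp]
  calc _ ≤ Real.exp (c * z) * (4 * (‖u‖ * ‖v‖)) := by gcongr; exact abs_omegaForm_le _ _
    _ ≤ Real.exp (c * z) * (4 * ((C₁ * Real.exp (a * z)) * (C₂ * Real.exp (b * z)))) := by
        have := (norm_nonneg _).trans hu
        gcongr
    _ = 4 * (C₁ * C₂) * (Real.exp (c * z) * Real.exp (a * z) * Real.exp (b * z)) := by ring
    _ = _ := by rw [← Real.exp_add, ← Real.exp_add, ← hd]; ring_nf

/-- The Pfaffian identity that turns the integrand of the two-vector computation into the product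
of two values of the symplectic form. -/
theorem wedgeFour_paramMatrix {a p d : Fin 4 → ℝ} (h₁ : omegaForm a p = 0)
    (h₂ : omegaForm p d = 0) :
    wedgeFour (induced (paramMatrix σ α) (wedgeTwo (fun i => (a i : ℂ)) fun i => (p i : ℂ)))
      (wedgeTwo (fun i => (p i : ℂ)) fun i => (d i : ℂ)) =
      ((-(omegaForm a d * (p 0 ^ 2 / σ - p 1 ^ 2 / α)) : ℝ) : ℂ) := by
  have h₁' : (((omegaForm a p : ℝ)) : ℂ) = 0 := by rw [h₁, Complex.ofReal_zero]
  have h₂' : (((omegaForm p d : ℝ)) : ℂ) = 0 := by rw [h₂, Complex.ofReal_zero]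
  rw [induced_wedgeTwo]
  simp only [omegaForm] at h₁' h₂' ⊢
  push_cast at h₁' h₂' ⊢
  simp [paramMatrix, wedgeTwo, wedgeFour, pairFst, pairSnd, Matrix.mulVec, dotProduct,
    Matrix.single]
  -- This is x ∧ y ∧ z ∧ w = ω(x,y)ω(z,w) - ω(x,z)ω(y,w) + ω(x,w)ω(y,z) for a, Bp, p, d; the term
  -- with Ba repeats p and vanishes. The coefficients are ω(a, Bp) and ω(d, Bp).
  linear_combination ((a 0 : ℂ) * (p 0 / σ) - a 1 * (p 1 / α)) * h₂' +
    ((d 0 : ℂ) * (p 0 / σ) - d 1 * (p 1 / α)) * h₁'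

theorem IsTravelingWave.integrable_integrand (hw : IsTravelingWave f g σ α c ν₁ ν₂ uh vh) :
    Integrable fun z : ℝ =>
      Real.exp (c * z) * ((deriv uh z) ^ 2 / σ - (deriv vh z) ^ 2 / α) := by
  have hσ := hw.sigma_pos
  have hα := hw.alpha_pos
  have h2 := hw.eigenvalue_neg
  have hs := rateMinus_add_ratePlus c ν₂
  have hm := rateMinus_neg (c := c) h2
  have hp := ratePlus_pos (c := c) h2
  obtain ⟨C, hC0, hC⟩ := hw.exists_decay
  have hcont : Continuous fun z : ℝ =>
      Real.exp (c * z) * ((deriv uh z) ^ 2 / σ - (deriv vh z) ^ 2 / α) := by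
    have h3 := hw.contDiff_u.continuous_deriv one_le_two
    have h4 := hw.contDiff_v.continuous_deriv one_le_two
    fun_prop
  have hb : ∀ z, ∀ μ ∈ ({rateMinus c ν₂, ratePlus c ν₂} : Set ℝ),
      ‖Real.exp (c * z) * ((deriv uh z) ^ 2 / σ - (deriv vh z) ^ 2 / α)‖ ≤
        (C ^ 2 / σ + C ^ 2 / α) * Real.exp ((c + 2 * μ) * z) := fun z μ hμ => by
    have h := (hC z μ hμ).2.2
    have hu : |deriv uh z| ≤ C * Real.exp (μ * z) :=
      (norm_le_pi_norm (profileDeriv σ α uh vh z) 0).trans h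
    have hv : |deriv vh z| ≤ C * Real.exp (μ * z) :=
      (norm_le_pi_norm (profileDeriv σ α uh vh z) 1).trans h
    rw [Real.norm_eq_abs, abs_mul, Real.abs_exp]
    have e1 : |(deriv uh z) ^ 2 / σ - (deriv vh z) ^ 2 / α| ≤
        (C * Real.exp (μ * z)) ^ 2 / σ + (C * Real.exp (μ * z)) ^ 2 / α := by
      refine (abs_sub _ _).trans ?_
      rw [abs_div, abs_div, abs_pow, abs_pow, abs_of_pos hσ, abs_of_pos hα]
      gcongr
    calc _ ≤ Real.exp (c * z) *
          ((C * Real.exp (μ * z)) ^ 2 / σ + (C * Real.exp (μ * z)) ^ 2 / α) := by gcongr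
      _ = (C ^ 2 / σ + C ^ 2 / α) * (Real.exp (c * z) * Real.exp (μ * z) ^ 2) := by ring
      _ = _ := by
        rw [← Real.exp_nat_mul, ← Real.exp_add]
        push_cast
        ring_nf
  -- As c = -(μ₂ + μ₃), the exponents c + 2μ₃ = μ₃ - μ₂ on the left and c + 2μ₂ = μ₂ - μ₃ on the
  -- right have the right signs.
  rw [← integrableOn_univ, ← Set.Iic_union_Ioi (a := (0 : ℝ)), integrableOn_union]
  constructor
  · refine Integrable.mono' ((integrableOn_exp_mul_Iic (a := c + 2 * ratePlus c ν₂) (by linarith)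
      0).const_mul _) hcont.aestronglyMeasurable (ae_of_all _ fun z => hb z _ (Or.inr rfl))
  · refine Integrable.mono' ((integrableOn_exp_mul_Ioi (a := c + 2 * rateMinus c ν₂) (by linarith)
      0).const_mul _) hcont.aestronglyMeasurable (ae_of_all _ fun z => hb z _ (Or.inl rfl))

theorem norm_le_of_norm_exp_smul_le {E : Type*} [NormedAddCommGroup E] [NormedSpace ℂ E] {x : E}
    {m : ℂ} {a C z : ℝ} (h : ‖Complex.exp (-m * z) • x‖ ≤ C) (ha : m.re * z ≤ a * z) :
    ‖x‖ ≤ C * Real.exp (a * z) := by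
  have hC := (norm_nonneg _).trans h
  rw [norm_smul, Complex.norm_exp] at h
  have h1 : ‖x‖ ≤ C * Real.exp (m.re * z) := by
    refine norm_le_mul_exp (μ := m.re) (z := z) ?_
    rw [norm_smul, Real.norm_eq_abs, Real.abs_exp]
    simpa using h
  exact h1.trans (by gcongr)

/-- The true rate moves with λ; giving up ε yields one exponential valid for all λ near 0, as
domination requires. At z = 0 the weight is 1 and the Lipschitz bound is for the solution itself. -/
theorem IsStableTwoVector.exists_bound (hw : IsTravelingWave f g σ α c ν₁ ν₂ uh vh)
    {U : Set ℂ} (hU : IsEvansDomain f g σ α c U) {ζ : ℂ → Fin 6 → ℂ} {Es : ℂ → ℝ → Fin 6 → ℂ}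
    (hEs : IsStableTwoVector f g σ α c ν₁ ν₂ uh vh U ζ Es) {ε : ℝ} (hε : 0 < ε) :
    ∃ C, (∀ᶠ lam in 𝓝 (0 : ℂ), ‖Es lam 0 - Es 0 0‖ ≤ C * ‖lam‖ ∧ ∀ z : ℝ, 0 ≤ z →
      ‖Es lam z‖ ≤ C * Real.exp ((rateMinus c ν₁ + rateMinus c ν₂ + ε) * z)) ∧
      ∀ z, 0 ≤ z → Tendsto (fun lam => Es lam z) (𝓝 0) (𝓝 (Es 0 z)) := by
  obtain ⟨C, hC⟩ := hEs.exists_lipschitz hw hU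
  have h2 := hw.eigenvalue_neg
  have h1 := hw.eigenvalue_lt.trans h2
  have hm : ContinuousAt (fun lam => muMinus c ν₁ lam + muMinus c ν₂ lam) 0 :=
    ((differentiableAt_muMinus h1).add (differentiableAt_muMinus h2)).continuousAt
  have hre : ∀ᶠ lam in 𝓝 (0 : ℂ), (muMinus c ν₁ lam + muMinus c ν₂ lam).re <
      rateMinus c ν₁ + rateMinus c ν₂ + ε := by
    refine (Complex.continuous_re.continuousAt.comp hm).eventually (eventually_lt_nhds ?_)
    simp only [Function.comp, muMinus_zero c ν₁ h1.le, muMinus_zero c ν₂ h2.le, Complex.add_re,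
      Complex.ofReal_re]
    linarith
  refine ⟨C, ?_, fun z hz => tendsto_of_weighted_lipschitz hm (hC.mono fun lam h => (h z hz).2)⟩
  filter_upwards [hC, hre] with lam h3 h4
  refine ⟨by simpa using (h3 0 le_rfl).2, fun z hz => ?_⟩
  exact norm_le_of_norm_exp_smul_le (h3 z hz).1 (by gcongr)

theorem IsUnstableTwoVector.exists_bound (hw : IsTravelingWave f g σ α c ν₁ ν₂ uh vh)
    {U : Set ℂ} (hU : IsEvansDomain f g σ α c U) {ζ : ℂ → Fin 6 → ℂ} {Eu : ℂ → ℝ → Fin 6 → ℂ}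
    (hEu : IsUnstableTwoVector f g σ α c ν₁ ν₂ uh vh U ζ Eu) {ε : ℝ} (hε : 0 < ε) :
    ∃ C, (∀ᶠ lam in 𝓝 (0 : ℂ), ‖Eu lam 0 - Eu 0 0‖ ≤ C * ‖lam‖ ∧ ∀ z : ℝ, z ≤ 0 →
      ‖Eu lam z‖ ≤ C * Real.exp ((ratePlus c ν₂ + ratePlus c ν₁ - ε) * z)) ∧
      ∀ z, z ≤ 0 → Tendsto (fun lam => Eu lam z) (𝓝 0) (𝓝 (Eu 0 z)) := by
  obtain ⟨C, hC⟩ := hEu.exists_lipschitz hw hU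
  have h2 := hw.eigenvalue_neg
  have h1 := hw.eigenvalue_lt.trans h2
  have hm : ContinuousAt (fun lam => muPlus c ν₂ lam + muPlus c ν₁ lam) 0 :=
    ((differentiableAt_muPlus h2).add (differentiableAt_muPlus h1)).continuousAt
  have hre : ∀ᶠ lam in 𝓝 (0 : ℂ), ratePlus c ν₂ + ratePlus c ν₁ - ε <
      (muPlus c ν₂ lam + muPlus c ν₁ lam).re := by
    refine (Complex.continuous_re.continuousAt.comp hm).eventually (eventually_gt_nhds ?_)
    simp only [Function.comp, muPlus_zero c ν₁ h1.le, muPlus_zero c ν₂ h2.le, Complex.add_re,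
      Complex.ofReal_re]
    linarith
  refine ⟨C, ?_, fun z hz => tendsto_of_weighted_lipschitz hm (hC.mono fun lam h => (h z hz).2)⟩
  filter_upwards [hC, hre] with lam h3 h4
  refine ⟨by simpa using (h3 0 le_rfl).2, fun z hz => ?_⟩
  exact norm_le_of_norm_exp_smul_le (h3 z hz).1 (by nlinarith)

end Evans

/-! ### The derivative of the Evans function at zero -/

section Main

variable {f g : ℝ → ℝ} {σ α c ν₁ ν₂ : ℝ} {uh vh : ℝ → ℝ}

theorem norm_wedgeTwo_complexify_le {u v : ℝ → Fin 4 → ℝ} {z C₁ C₂ a b : ℝ}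
    (hu : ‖u z‖ ≤ C₁ * Real.exp (a * z)) (hv : ‖v z‖ ≤ C₂ * Real.exp (b * z)) :
    ‖wedgeTwo (complexify u z) (complexify v z)‖ ≤ 2 * (C₁ * C₂) * Real.exp ((a + b) * z) := by
  refine (norm_wedgeTwo_le _ _).trans ?_
  rw [norm_complexify, norm_complexify]
  calc _ ≤ 2 * ((C₁ * Real.exp (a * z)) * (C₂ * Real.exp (b * z))) := by
        have := (norm_nonneg _).trans hu
        gcongr
    _ = 2 * (C₁ * C₂) * (Real.exp (a * z) * Real.exp (b * z)) := by ring
    _ = _ := by rw [← Real.exp_add]; ring_nf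

/-- Ω(u₁, φ') is constant and bounded by a multiple of e^{(c + μ₁ + μ₂)z} for z ≥ 0, where c + μ₁ +
μ₂ = μ₂ - μ₄ < 0. -/
theorem IsTravelingWave.omegaForm_stable_eq_zero (hw : IsTravelingWave f g σ α c ν₁ ν₂ uh vh)
    {u : ℝ → Fin 4 → ℝ} (hu : IsExpSolution f g σ α c uh vh (rateMinus c ν₁) atTop u) (z : ℝ) :
    omegaForm (u z) (profileDeriv σ α uh vh z) = 0 := by
  obtain ⟨η, -, -, hη⟩ := hu.limit
  have hc : Continuous u :=
    continuous_iff_continuousAt.2 fun z => (hu.solution z).continuousAt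
  obtain ⟨C₁, hC₁⟩ := exists_norm_le_of_tendsto_atTop (by fun_prop) hη
  obtain ⟨C₂, -, hC₂⟩ := hw.exists_decay
  have o := ratePlus_lt_ratePlus (c := c) hw.eigenvalue_lt hw.eigenvalue_neg
  have o' := (rateMinus_neg (c := c) hw.eigenvalue_neg).trans (ratePlus_pos (c := c) hw.eigenvalue_neg)
  have s := rateMinus_add_ratePlus c ν₁
  have h : weightedOmega c z (u z) (profileDeriv σ α uh vh z) = 0 := by
    refine eq_zero_of_norm_le_exp (ε := ratePlus c ν₁ - rateMinus c ν₂) (K := 4 * (C₁ * C₂))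
      (by linarith) fun s hs => ?_
    rw [weightedOmega_eq hw.sigma_pos.ne' hw.alpha_pos.ne' hu.solution
      hw.hasDerivAt_profileDeriv z s]
    exact abs_weightedOmega_le (norm_le_mul_exp (hC₁ s hs)) (hC₂ s _ (Or.inl rfl)).2.2
      (by linarith)
  exact (mul_eq_zero.1 h).resolve_left (Real.exp_pos _).ne'

theorem IsTravelingWave.omegaForm_unstable_eq_zero
    (hw : IsTravelingWave f g σ α c ν₁ ν₂ uh vh)
    {u : ℝ → Fin 4 → ℝ} (hu : IsExpSolution f g σ α c uh vh (ratePlus c ν₁) atBot u) (z : ℝ) :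
    omegaForm (profileDeriv σ α uh vh z) (u z) = 0 := by
  obtain ⟨η, -, -, hη⟩ := hu.limit
  have hc : Continuous u :=
    continuous_iff_continuousAt.2 fun z => (hu.solution z).continuousAt
  obtain ⟨C₁, hC₁⟩ := exists_norm_le_of_tendsto_atTop (by fun_prop)
    (hη.comp tendsto_neg_atTop_atBot)
  obtain ⟨C₂, -, hC₂⟩ := hw.exists_decay
  have o := rateMinus_lt_rateMinus (c := c) hw.eigenvalue_lt hw.eigenvalue_neg
  have o' := (rateMinus_neg (c := c) hw.eigenvalue_neg).trans (ratePlus_pos (c := c) hw.eigenvalue_neg)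
  have s := rateMinus_add_ratePlus c ν₁
  have h : weightedOmega c z (profileDeriv σ α uh vh z) (u z) = 0 := by
    refine eq_zero_of_norm_le_exp (ε := ratePlus c ν₂ - rateMinus c ν₁) (K := 4 * (C₂ * C₁))
      (by linarith) fun s hs => ?_
    rw [weightedOmega_eq hw.sigma_pos.ne' hw.alpha_pos.ne' hw.hasDerivAt_profileDeriv hu.solution
      z (-s)]
    have h1 := hC₁ s hs
    simp only [Function.comp] at h1
    refine (abs_weightedOmega_le (hC₂ (-s) _ (Or.inr rfl)).2.2 (norm_le_mul_exp h1)
      (d := ratePlus c ν₂ - rateMinus c ν₁) (by linarith)).trans (le_of_eq ?_)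
    ring_nf
  exact (mul_eq_zero.1 h).resolve_left (Real.exp_pos _).ne'

theorem evansFunction_eq {Es Eu : ℂ → ℝ → Fin 6 → ℂ} {lam : ℂ}
    (hEs : ∀ z, HasDerivAt (Es lam) (induced (matrixA f g σ α c uh vh lam z) (Es lam z)) z)
    (hEu : ∀ z, HasDerivAt (Eu lam) (induced (matrixA f g σ α c uh vh lam z) (Eu lam z)) z)
    (z z' : ℝ) : evansFunction c Es Eu z lam = evansFunction c Es Eu z' lam :=
  eq_of_hasDerivAt_zero (h := fun z => evansFunction c Es Eu z lam)
    (fun z => (hasDerivAt_exp_mul_wedgeFour (hEs z) (hEu z)).congr_deriv (by simp)) z z'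

/-- The integrand of the derivative of the Evans function in two-vector form. -/
def evansIntegrand (σ α c : ℝ) (Z W : ℝ → Fin 6 → ℂ) (z : ℝ) : ℂ :=
  Complex.exp (2 * (c : ℂ) * z) * wedgeFour (inducedCLM (paramMatrix σ α) (Z z)) (W z)

theorem continuous_evansIntegrand {Z W : ℝ → Fin 6 → ℂ} (hZ : Continuous Z) (hW : Continuous W) :
    Continuous (evansIntegrand σ α c Z W) := by
  unfold evansIntegrand
  exact Continuous.mul (by fun_prop) (continuous_wedgeFour (by fun_prop) hW)

theorem evansIntegrand_zero (hw : IsTravelingWave f g σ α c ν₁ ν₂ uh vh) {u₁ u₄ : ℝ → Fin 4 → ℝ}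
    (hu₁ : IsExpSolution f g σ α c uh vh (rateMinus c ν₁) atTop u₁)
    (hu₄ : IsExpSolution f g σ α c uh vh (ratePlus c ν₁) atBot u₄) {Z W : ℝ → Fin 6 → ℂ}
    (hZ : ∀ z, Z z = wedgeTwo (complexify u₁ z) (complexify (profileDeriv σ α uh vh) z))
    (hW : ∀ z, W z = wedgeTwo (complexify (profileDeriv σ α uh vh) z) (complexify u₄ z))
    (z₀ z : ℝ) :
    evansIntegrand σ α c Z W z = ((-(weightedOmega c z₀ (u₁ z₀) (u₄ z₀) *
      (Real.exp (c * z) * ((deriv uh z) ^ 2 / σ - (deriv vh z) ^ 2 / α))) : ℝ) : ℂ) := by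
  have h := wedgeFour_paramMatrix (σ := σ) (α := α) (hw.omegaForm_stable_eq_zero hu₁ z)
    (hw.omegaForm_unstable_eq_zero hu₄ z)
  rw [evansIntegrand, hZ, hW, weightedOmega_eq hw.sigma_pos.ne' hw.alpha_pos.ne' hu₁.solution
    hu₄.solution z₀ z]
  have h' : wedgeFour (induced (paramMatrix σ α) (wedgeTwo (complexify u₁ z)
      (complexify (profileDeriv σ α uh vh) z))) (wedgeTwo
      (complexify (profileDeriv σ α uh vh) z) (complexify u₄ z)) = _ := h
  rw [inducedCLM_apply, h', weightedOmega,
    show (2 * (c : ℂ) * z) = ((c * z : ℝ) : ℂ) + ((c * z : ℝ) : ℂ) by push_cast; ring,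
    Complex.exp_add]
  simp only [profileDeriv, Matrix.cons_val]
  push_cast
  ring

theorem hasDerivAt_evansFunction_zero (hw : IsTravelingWave f g σ α c ν₁ ν₂ uh vh)
    {U : Set ℂ} (hU : IsEvansDomain f g σ α c U)
    {ζs ζu : ℂ → Fin 6 → ℂ} {Es Eu : ℂ → ℝ → Fin 6 → ℂ}
    (hEs : IsStableTwoVector f g σ α c ν₁ ν₂ uh vh U ζs Es)
    (hEu : IsUnstableTwoVector f g σ α c ν₁ ν₂ uh vh U ζu Eu)
    {u₁ u₄ : ℝ → Fin 4 → ℝ}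
    (hu₁ : IsExpSolution f g σ α c uh vh (rateMinus c ν₁) atTop u₁)
    (hu₄ : IsExpSolution f g σ α c uh vh (ratePlus c ν₁) atBot u₄)
    (hZ : ∀ z, Es 0 z = wedgeTwo (complexify u₁ z) (complexify (profileDeriv σ α uh vh) z))
    (hW : ∀ z, Eu 0 z = wedgeTwo (complexify (profileDeriv σ α uh vh) z) (complexify u₄ z)) :
    HasDerivAt (evansFunction c Es Eu 0) (-∫ z, evansIntegrand σ α c (Es 0) (Eu 0) z) 0 := by
  have h2 := hw.eigenvalue_neg
  have s₁ := rateMinus_add_ratePlus c ν₁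
  have s₂ := rateMinus_add_ratePlus c ν₂
  -- At +∞ the weighted cross term has exponent 2c + (μ₁ + μ₂) + (μ₂ + μ₄) = μ₂ - μ₃, and at -∞ its
  -- mirror image μ₃ - μ₂. Half of this gap absorbs the loss ε and leaves decay at rate ε.
  set ε := (ratePlus c ν₂ - rateMinus c ν₂) / 2 with hε'
  have hε : 0 < ε := by linarith [rateMinus_neg (c := c) h2, ratePlus_pos (c := c) h2]
  have h0 := hU.halfPlane 0 le_rfl
  have hcs : ∀ lam ∈ U, Continuous (Es lam) := fun lam h =>
    continuous_iff_continuousAt.2 fun z => (hEs.solution lam h z).continuousAt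
  have hcu : ∀ lam ∈ U, Continuous (Eu lam) := fun lam h =>
    continuous_iff_continuousAt.2 fun z => (hEu.solution lam h z).continuousAt
  obtain ⟨Cs, hCs, hs⟩ := hEs.exists_bound hw hU hε
  obtain ⟨Cu, hCu, hu⟩ := hEu.exists_bound hw hU hε
  obtain ⟨K, -, hK⟩ := hw.exists_decay
  obtain ⟨K₁, -, hK₁⟩ := hw.exists_growth hu₁.solution
  obtain ⟨K₄, hK₄, -⟩ := hw.exists_growth hu₄.solution
  have bu : ∀ z, 0 ≤ z → ‖Eu 0 z‖ ≤
      2 * (K * K₄) * Real.exp ((rateMinus c ν₂ + ratePlus c ν₁) * z) := fun z hz => by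
    rw [hW]
    exact norm_wedgeTwo_complexify_le (hK z _ (Or.inl rfl)).2.2 (hK₄ z hz)
  have bs : ∀ z, z ≤ 0 → ‖Es 0 z‖ ≤
      2 * (K₁ * K) * Real.exp ((rateMinus c ν₁ + ratePlus c ν₂) * z) := fun z hz => by
    rw [hZ]
    exact norm_wedgeTwo_complexify_le (hK₁ z hz) (hK z _ (Or.inr rfl)).2.2
  set T := inducedCLM (paramMatrix σ α)
  have ep : 2 * c + (rateMinus c ν₁ + rateMinus c ν₂ + ε) + (rateMinus c ν₂ + ratePlus c ν₁) =
    -ε := by linarith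
  have em : 2 * c + (rateMinus c ν₁ + ratePlus c ν₂) + (ratePlus c ν₂ + ratePlus c ν₁ - ε) =
    ε := by linarith
  obtain ⟨ip, tp⟩ := tendsto_inv_mul_of_hasDerivAt
    (F := fun lam z => Complex.exp (2 * (c : ℂ) * z) * wedgeFour (Es lam z) (Eu 0 z))
    (q := fun lam => evansIntegrand σ α c (Es lam) (Eu 0)) hε
    (mem_of_superset hU.mem_nhds fun lam h z => by
      simpa [evansIntegrand] using
        hasDerivAt_exp_mul_wedgeFour (hEs.solution lam h z) (hEu.solution 0 h0 z))
    (mem_of_superset hU.mem_nhds fun lam h => continuous_evansIntegrand (hcs lam h) (hcu 0 h0))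
    (hCs.mono fun lam h z hz => norm_exp_mul_wedgeFour_le (ContinuousLinearMap.id ℂ _)
      (h.2 z hz) (bu z hz) ep)
    (hCs.mono fun lam h z hz => norm_exp_mul_wedgeFour_le T (h.2 z hz) (bu z hz) ep)
    (fun z hz => by
      have h1 : Continuous fun Z => Complex.exp (2 * (c : ℂ) * z) * wedgeFour (T Z) (Eu 0 z) :=
        Continuous.mul (by fun_prop) (continuous_wedgeFour (by fun_prop) (by fun_prop))
      exact (h1.tendsto _).comp (hs z hz))
  obtain ⟨im, tm⟩ := tendsto_inv_mul_of_hasDerivAt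
    (F := fun lam z => Complex.exp (2 * (c : ℂ) * (-z : ℝ)) * wedgeFour (Es 0 (-z)) (Eu lam (-z)))
    (q := fun lam z => evansIntegrand σ α c (Es 0) (Eu lam) (-z)) hε
    (mem_of_superset hU.mem_nhds fun lam h z => by
      have h1 := (hasDerivAt_exp_mul_wedgeFour (hEs.solution 0 h0 (-z))
        (hEu.solution lam h (-z))).scomp z (hasDerivAt_neg z)
      refine h1.congr_deriv ?_
      simp [evansIntegrand])
    (mem_of_superset hU.mem_nhds fun lam h =>
      (continuous_evansIntegrand (hcs 0 h0) (hcu lam h)).comp continuous_neg)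
    (hCu.mono fun lam h z hz => by
      have h3 := norm_exp_mul_wedgeFour_le (ContinuousLinearMap.id ℂ _) (bs (-z) (by linarith))
        (h.2 (-z) (by linarith)) em
      rwa [show ε * -z = -ε * z by ring] at h3)
    (hCu.mono fun lam h z hz => by
      have h3 := norm_exp_mul_wedgeFour_le T (bs (-z) (by linarith)) (h.2 (-z) (by linarith)) em
      rwa [show ε * -z = -ε * z by ring] at h3)
    (fun z hz => by
      have h1 : Continuous fun W =>
          Complex.exp (2 * (c : ℂ) * (-z : ℝ)) * wedgeFour (T (Es 0 (-z))) W :=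
        Continuous.mul (by fun_prop) (continuous_wedgeFour (by fun_prop) (by fun_prop))
      exact (h1.tendsto _).comp (hu (-z) (by linarith)))
  -- Both differences are O(λ), so their product divided by λ tends to 0.
  have tq : Tendsto (fun lam => lam⁻¹ * wedgeFour (Es lam 0 - Es 0 0) (Eu lam 0 - Eu 0 0))
      (𝓝[≠] 0) (𝓝 0) := by
    refine squeeze_zero_norm' (a := fun lam => 6 * (Cs * Cu) * ‖lam‖) ?_ ?_
    · filter_upwards [self_mem_nhdsWithin, nhdsWithin_le_nhds hCs, nhdsWithin_le_nhds hCu]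
        with lam h1 h2 h3
      have h1' : 0 < ‖lam‖ := norm_pos_iff.2 h1
      rw [norm_mul, norm_inv, inv_mul_le_iff₀ h1']
      refine (norm_wedgeFour_le _ _).trans ?_
      calc _ ≤ 6 * ((Cs * ‖lam‖) * (Cu * ‖lam‖)) := by
            have := (norm_nonneg _).trans h2.1
            gcongr
            exacts [h2.1, h3.1]
        _ = _ := by ring
    · refine Tendsto.mono_left ?_ nhdsWithin_le_nhds
      simpa using (tendsto_norm_zero (E := ℂ)).const_mul (6 * (Cs * Cu))
  have hD0 : wedgeFour (Es 0 0) (Eu 0 0) = 0 := by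
    rw [hZ, hW]
    simp only [wedgeFour, wedgeTwo, pairFst, pairSnd, Matrix.cons_val]
    ring
  have im' : IntegrableOn (evansIntegrand σ α c (Es 0) (Eu 0)) (Set.Iic 0) := by
    have := im.comp_neg
    rw [integrableOn_Iic_iff_integrableOn_Iio]
    simpa using this
  rw [integral_comp_neg_Ioi, neg_zero] at tm
  rw [hasDerivAt_iff_tendsto_slope, ← intervalIntegral.integral_Iic_add_Ioi im' ip]
  -- The three limits add up to the difference quotient of D, by bilinearity and D(0) = 0.
  have := (tq.add tp).add tm
  rw [show 0 + -(∫ z in Set.Ioi 0, evansIntegrand σ α c (Es 0) (Eu 0) z) +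
    -(∫ z in Set.Iic 0, evansIntegrand σ α c (Es 0) (Eu 0) z) =
    -((∫ z in Set.Iic 0, evansIntegrand σ α c (Es 0) (Eu 0) z) +
      ∫ z in Set.Ioi 0, evansIntegrand σ α c (Es 0) (Eu 0) z) by ring] at this
  refine this.congr fun lam => ?_
  simp only [slope_def_module, evansFunction, sub_zero, smul_eq_mul, Complex.ofReal_zero, mul_zero,
    Complex.exp_zero, one_mul, hD0, wedgeFour_sub_left, wedgeFour_sub_right]
  ring

end Main

end

theorem lemma4p2
    (f g : ℝ → ℝ) (σ α c ν₁ ν₂ : ℝ) (uh vh : ℝ → ℝ)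
    (hwave : IsTravelingWave f g σ α c ν₁ ν₂ uh vh)
    (U : Set ℂ) (hU : IsEvansDomain f g σ α c U)
    (ζs ζu : ℂ → Fin 6 → ℂ) (Es Eu : ℂ → ℝ → Fin 6 → ℂ)
    (hEs : IsStableTwoVector f g σ α c ν₁ ν₂ uh vh U ζs Es)
    (hEu : IsUnstableTwoVector f g σ α c ν₁ ν₂ uh vh U ζu Eu)
    (u₁ u₄ : ℝ → Fin 4 → ℝ)
    (hu₁ : IsExpSolution f g σ α c uh vh (rateMinus c ν₁) atTop u₁)
    (hu₄ : IsExpSolution f g σ α c uh vh (ratePlus c ν₁) atBot u₄)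
    (hnorm_s : Tendsto
      (fun z : ℝ => fun k : Fin 6 => ((Real.exp (-(rateMinus c ν₁ + rateMinus c ν₂) * z) *
        wedgeTwo (u₁ z) (profileDeriv σ α uh vh z) k : ℝ) : ℂ)) atTop (𝓝 (ζs 0)))
    (hnorm_u : Tendsto
      (fun z : ℝ => fun k : Fin 6 => ((Real.exp (-(ratePlus c ν₂ + ratePlus c ν₁) * z) *
        wedgeTwo (profileDeriv σ α uh vh z) (u₄ z) k : ℝ) : ℂ)) atBot (𝓝 (ζu 0))) :
    (∀ lam ∈ U, ∀ z z' : ℝ, evansFunction c Es Eu z lam = evansFunction c Es Eu z' lam) ∧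
    (∀ z z' : ℝ, weightedOmega c z (u₁ z) (u₄ z) = weightedOmega c z' (u₁ z') (u₄ z')) ∧
    Integrable (fun z : ℝ =>
      Real.exp (c * z) * ((deriv uh z) ^ 2 / σ - (deriv vh z) ^ 2 / α)) ∧
    ∀ z z₀ : ℝ, HasDerivAt (evansFunction c Es Eu z)
      ((weightedOmega c z₀ (u₁ z₀) (u₄ z₀) *
        ∫ x : ℝ, Real.exp (c * x) * ((deriv uh x) ^ 2 / σ - (deriv vh x) ^ 2 / α) : ℝ) : ℂ) 0 := by
  have hEs0 := hEs.at_zero_eq hwave hU hu₁.solution hwave.hasDerivAt_profileDeriv hnorm_s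
  have hEu0 := hEu.at_zero_eq hwave hU hwave.hasDerivAt_profileDeriv hu₄.solution hnorm_u
  have hconst : ∀ lam ∈ U, ∀ z z' : ℝ,
      evansFunction c Es Eu z lam = evansFunction c Es Eu z' lam := fun lam h =>
    evansFunction_eq (hEs.solution lam h) (hEu.solution lam h)
  refine ⟨hconst, weightedOmega_eq hwave.sigma_pos.ne' hwave.alpha_pos.ne' hu₁.solution
    hu₄.solution, hwave.integrable_integrand, fun z z₀ => ?_⟩
  have h := hasDerivAt_evansFunction_zero hwave hU hEs hEu hu₁ hu₄ hEs0 hEu0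
  -- Independence of z is available on U only, which is a neighbourhood of 0; this transfers the
  -- derivative from the base point 0 to any z.
  refine (h.congr_of_eventuallyEq (mem_of_superset hU.mem_nhds fun lam hl =>
    hconst lam hl z 0)).congr_deriv ?_
  simp_rw [evansIntegrand_zero hwave hu₁ hu₄ hEs0 hEu0 z₀]
  rw [integral_complex_ofReal, integral_neg, integral_const_mul, Complex.ofReal_neg, neg_neg]
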